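/- **Setting.** Let $M=\bigoplus_{i\in\mathbb Z}\mathbb Z b_i$, let $\bigwedge M$ be its exterior algebra, and let $F=(\bigwedge M\otimes_{\mathbb Z}[M])/W$ be the fermionic Fock space, where $[M]$ is the free abelian group on symbols $[\mathbf b]_m$ $(m\in\mathbb Z)$ and $W$ is the $\bigwedge M$-submodule generated by all $b_m\otimes[\mathbf b]_{m-1}-1\otimes[\mathbf b]_m$ and $b_m\otimes[\mathbf b]_m$. Write $u\wedge[\mathbf b]_m$ for the class of $u\otimes[\mathbf b]_m$. For a partition $\lambda$ and $r\ge\ell(\lambda)$ put $[\mathbf b]_{m+\lambda}=b_{m+\lambda_1}\wedge b_{m-1+\lambda_2}\wedge\cdots\wedge b_{m-r+1+\lambda_r}\wedge[\mathbf b]_{m-r}$, and let $F_m$ be the span of all $[\mathbf b]_{m+\lambda}$. *Schubert derivations.* Let $\sigma_+(z)$, $\sigma_-(z)$, $\overline\sigma_-(z)$ be the Hasse–Schmidt derivations (multiplicative $\mathbb Z$-linear maps) $\bigwedge M\to\bigwedge M[[z^{\pm1}]]$ with $\sigma_\pm(z)b_j=\sum_{i\ge0}b_{j\pm i}z^{\pm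 i}$ and $\overline\sigma_-(z)b_j=b_j-b_{j-1}z^{-1}$, extended to $F$ by $\sigma_+(z)(u\wedge[\mathbf b]_m)=\sigma_+(z)u\wedge\sigma_+(z)b_m\wedge[\mathbf b]_{m-1}$, $\sigma_-(z)(u\wedge[\mathbf b]_m)=\sigma_-(z)u\wedge[\mathbf b]_m$ and $\overline\sigma_-(z)(u\wedge[\mathbf b]_m)=\overline\sigma_-(z)u\wedge[\mathbf b]_m$. Write $\sigma_+(z)=\sum_{n\ge0}\sigma_nz^n$. *Action of $gl_\infty(\mathbb Z)$.* Let $\mathcal B_{ij}\in\mathrm{End}(M)$ be the elementary matrix $b_k\mapsto\delta_{jk}b_i$, and $\delta(\mathcal B_{ij})$ the derivation of $\bigwedge M$ extending it. It acts on $F$ by $\delta(\mathcal B_{ij})(u\wedge[\mathbf b]_n)=\delta(\mathcal B_{ij})(u)\wedge[\mathbf b]_n$ whenever $n<j$; let $\delta_m$ be its restriction to $F_m$. *Boson–fermion correspondence.* Let $B=\mathbb Z[e_1,e_2,\dots]$, $E(z)=1+\sum_{j\ge1}(-1)^je_jz^j$ and $\sum_{n\in\mathbb Z} h_nz^n=1/E(z)$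 (so $h_n=0$ for $n<0$). The operators $\sigma_n$ on $F$ commute, and $F$ is a $B$-module with $h_n$ acting as $\sigma_n$. For $r\ge\ell(\lambda)$ put $\Delta_\lambda(H)=\det(h_{\lambda_j-j+i})_{1\le i,j\le r}$. **Statement.** Let $m\in\mathbb Z$. 1. The map $B\to F$, $f\mapsto f\,[\mathbf b]_m$, is injective with image $F_m$, and $\Delta_\lambda(H)[\mathbf b]_m=[\mathbf b]_{m+\lambda}$ for every partition $\lambda$. Moreover there are operators $\sigma_-(z),\overline\sigma_-(z):B\to B[z^{-1}]$ such that $(\sigma_-(z)f)[\mathbf b]_0=\sigma_-(z)(f[\mathbf b]_0)$ and $(\overline\sigma_-(z)f)[\mathbf b]_0=\overline\sigma_-(z)(f[\mathbf b]_0)$ for all $f\in B$, and operators $\mathcal B^{(m)}_{ij}:B\to B$ $(i,j\in\mathbb Z)$ such that $(\mathcal B^{(m)}_{ij}f)[\mathbf b]_m=\delta_m(\mathcal B_{ij})(f[\mathbf b]_m)$ for all $f\in B$; by injectivity they are unique. 2. Put $\mathcal B^{(m)}(z,w)=\sum_{i,j\in\mathbb Z}\mathcal B^{(m)}_{ij}z^iw^{-j}$.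 Then $$\mathcal B^{(m)}(z,w)=\frac{z^m}{w^m}\; i_{z,w}\frac{z}{z-w}\;\Gamma(z,w),\qquad \Gamma(z,w)=\frac{E(w)}{E(z)}\,\overline\sigma_-(z)\,\sigma_-(w),$$ where $i_{z,w}\frac{z}{z-w}=\sum_{k\ge0}(w/z)^k$. That is, for all $f\in B$ and $i,j\in\mathbb Z$, $\mathcal B^{(m)}_{ij}f$ is the coefficient of $z^iw^{-j}$ in the right-hand side applied to $f$, the products being taken in $B((z))((w))$. -/

import Mathlib

noncomputable section

namespace DJKM

/-! ### The free abelian group `M`, its exterior algebra and the fermionic Fock space -/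

/-- The free abelian group `M = ⨁_{i ∈ ℤ} ℤ b_i`. -/
abbrev M : Type := ℤ →₀ ℤ

/-- The exterior algebra of `M`. -/
abbrev ExtM : Type := ExteriorAlgebra ℤ M

/-- The basis vector `b_i`, seen in the exterior algebra. -/
def b (i : ℤ) : ExtM := ExteriorAlgebra.ι ℤ (Finsupp.single i 1)

/-- The tensor product of the exterior algebra with the free abelian group `[M]` on the symbols
`[b]_m`, `m ∈ ℤ`, as a left module over the exterior algebra. -/
abbrev PreFock : Type := TensorProduct ℤ ExtM (ℤ →₀ ℤ)

/-- `u ⊗ [b]_m`. -/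
def preVac (u : ExtM) (m : ℤ) : PreFock := TensorProduct.tmul ℤ u (Finsupp.single m 1)

/-- The submodule `W` generated by all `b_m ⊗ [b]_{m-1} - 1 ⊗ [b]_m` and all `b_m ⊗ [b]_m`. -/
def W : Submodule ExtM PreFock :=
  Submodule.span ExtM
    (Set.range (fun m : ℤ => preVac (b m) (m - 1) - preVac 1 m) ∪
      Set.range (fun m : ℤ => preVac (b m) m))

/-- The fermionic Fock space `F = (⋀M ⊗ [M]) / W`. -/
def F : Type := PreFock ⧸ W

instance : AddCommGroup F := inferInstanceAs (AddCommGroup (PreFock ⧸ W))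

/-- The action of the exterior algebra on `F` is written `u • φ`; it is the wedge product
of `u` with `φ`. -/
instance : Module ExtM F := inferInstanceAs (Module ExtM (PreFock ⧸ W))

/-- The class `[b]_m` in `F`. -/
def vac (m : ℤ) : F := W.mkQ (preVac 1 m)

theorem mkQ_preVac (u : ExtM) (m : ℤ) : (W.mkQ (preVac u m) : F) = u • vac m := by
  have h : preVac u m = u • preVac 1 m := by
    simp [preVac, TensorProduct.smul_tmul']
  rw [h, map_smul]; rfl

theorem b_smul_vac_pred (m : ℤ) : b m • vac (m - 1) = vac m := by
  rw [← mkQ_preVac]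
  refine (Submodule.Quotient.eq W).2 ?_
  exact Submodule.subset_span (Or.inl ⟨m, rfl⟩)

theorem b_smul_vac_self (m : ℤ) : b m • vac m = 0 := by
  rw [← mkQ_preVac]
  refine (Submodule.Quotient.mk_eq_zero W).2 ?_
  exact Submodule.subset_span (Or.inr ⟨m, rfl⟩)

/-- A family of additive maps `g m`, assembled to the additive map `u ⊗ [b]_m ↦ g m u`. -/
def preLift {A : Type} [AddCommGroup A] (g : ℤ → ExtM →+ A) : PreFock →+ A :=
  TensorProduct.liftAddHom
    ((Finsupp.liftAddHom (fun m : ℤ => (zmultiplesHom (ExtM →+ A)) (g m))).flip)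
    (by
      intro r x y
      change _ = ((Finsupp.liftAddHom
        (fun m : ℤ => (zmultiplesHom (ExtM →+ A)) (g m))).flip x) (r • y)
      rw [map_zsmul, map_zsmul]; rfl)

theorem preLift_preVac {A : Type} [AddCommGroup A] (g : ℤ → ExtM →+ A) (x : ExtM) (m : ℤ) :
    preLift g (preVac x m) = g m x := by
  simp [preLift, preVac]

theorem smul_preVac (x u : ExtM) (m : ℤ) : x • preVac u m = preVac (x * u) m := by
  simp [preVac, TensorProduct.smul_tmul']

/-- The universal property of `F`: a family of additive maps `g m`, thought of as
`u ↦ G (u ∧ [b]_m)`, which is compatible with the relations, induces an additive map `G`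
on `F`. -/
def liftF {A : Type} [AddCommGroup A] (g : ℤ → ExtM →+ A)
    (h1 : ∀ m x, g (m - 1) (x * b m) = g m x) (h2 : ∀ m x, g m (x * b m) = 0) : F →+ A :=
  QuotientAddGroup.lift W.toAddSubgroup (preLift g)
    (by
      intro y hy
      have key : ∀ y ∈ W, ∀ x : ExtM, preLift g (x • y) = 0 := by
        intro y hy
        refine Submodule.span_induction ?_ ?_ ?_ ?_ hy
        · rintro _ (⟨m, rfl⟩ | ⟨m, rfl⟩) x
          · simp only [smul_sub, smul_preVac, map_sub, preLift_preVac, h1, mul_one, sub_self]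
          · simp only [smul_preVac, preLift_preVac, h2]
        · intro x; simp
        · intro a c _ _ ha hc x
          rw [smul_add, map_add, ha, hc, add_zero]
        · intro a c _ hc x
          rw [smul_smul]; exact hc _
      have := key y hy 1
      rw [one_smul] at this
      exact this)

theorem liftF_smul_vac {A : Type} [AddCommGroup A] (g : ℤ → ExtM →+ A)
    (h1 : ∀ m x, g (m - 1) (x * b m) = g m x) (h2 : ∀ m x, g m (x * b m) = 0)
    (x : ExtM) (m : ℤ) : liftF g h1 h2 (x • vac m) = g m x := by
  rw [← mkQ_preVac]
  exact preLift_preVac g x m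

theorem F_induction {P : F → Prop} (h0 : P 0) (hadd : ∀ x y, P x → P y → P (x + y))
    (h : ∀ (u : ExtM) (m : ℤ), P (u • vac m)) (φ : F) : P φ := by
  obtain ⟨y, rfl⟩ := Submodule.mkQ_surjective W φ
  induction y using TensorProduct.induction_on with
  | zero => rw [map_zero]; exact h0
  | add x y hx hy => rw [map_add]; exact hadd _ _ hx hy
  | tmul u v =>
    induction v using Finsupp.induction_linear with
    | zero => rw [TensorProduct.tmul_zero, map_zero]; exact h0
    | add x y hx hy => rw [TensorProduct.tmul_add, map_add]; exact hadd _ _ hx hy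
    | single m c =>
      have e : (TensorProduct.tmul ℤ u (Finsupp.single m c) : PreFock) = preVac (c • u) m := by
        rw [preVac, TensorProduct.smul_tmul, Finsupp.smul_single]
        simp
      rw [e, mkQ_preVac]; exact h _ _

theorem b_mul_b_swap (i j : ℤ) : b i * b j = -(b j * b i) :=
  eq_neg_of_add_eq_zero_left (ExteriorAlgebra.ι_add_mul_swap _ _)

theorem b_mul_self (i : ℤ) : b i * b i = 0 := ExteriorAlgebra.ι_sq_zero _

theorem b_smul_vac_of_le {k m : ℤ} (h : k ≤ m) : b k • vac m = 0 := by
  induction m, h using Int.leInduction with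
  | base => exact b_smul_vac_self k
  | succ m _ ih =>
    have e := b_smul_vac_pred (m + 1)
    rw [add_sub_cancel_right] at e
    rw [← e, smul_smul, b_mul_b_swap, neg_smul, ← smul_smul, ih, smul_zero, neg_zero]

/-! ### Hasse-Schmidt derivations on the exterior algebra -/

/-- The linear map `v ↦ ∑ᵢ Dᵢ(v) tⁱ` from `M` to `(⋀M)[[t]]`. -/
def hsLin (D : ℕ → Module.End ℤ M) : M →ₗ[ℤ] PowerSeries ExtM where
  toFun v := PowerSeries.mk fun n => ExteriorAlgebra.ι ℤ (D n v)
  map_add' x y := by ext n; simp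
  map_smul' c x := by
    ext n
    rw [RingHom.id_apply, map_zsmul, PowerSeries.coeff_mk, PowerSeries.coeff_mk, map_zsmul,
      map_zsmul]

theorem hsLin_sq (D : ℕ → Module.End ℤ M) (v : M) : hsLin D v * hsLin D v = 0 := by
  ext n
  rw [PowerSeries.coeff_mul, map_zero]
  refine Finset.sum_involution (fun p _ => p.swap) ?_ ?_ ?_ ?_
  · intro p _
    simp only [hsLin, LinearMap.coe_mk, AddHom.coe_mk, PowerSeries.coeff_mk, Prod.fst_swap,
      Prod.snd_swap]
    exact ExteriorAlgebra.ι_add_mul_swap _ _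
  · intro p _ hne hswap
    apply hne
    have : p.1 = p.2 := (congrArg Prod.snd hswap)
    simp only [hsLin, LinearMap.coe_mk, AddHom.coe_mk, PowerSeries.coeff_mk, this]
    exact ExteriorAlgebra.ι_sq_zero _
  · intro p hp
    simpa [Finset.mem_antidiagonal, add_comm] using hp
  · intro p _; simp

/-- The unique Hasse-Schmidt derivation `⋀M → (⋀M)[[t]]`, that is, the unique homomorphism of
algebras, with `v ↦ ∑ᵢ Dᵢ(v) tⁱ` for `v ∈ M`. -/
def hs (D : ℕ → Module.End ℤ M) : ExtM →ₐ[ℤ] PowerSeries ExtM :=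
  ExteriorAlgebra.lift ℤ ⟨hsLin D, hsLin_sq D⟩

/-- The coefficient of `tⁿ` of a Hasse-Schmidt derivation, as an additive map. -/
def hsCoeff (D : ℕ → Module.End ℤ M) (n : ℕ) : ExtM →+ ExtM :=
  (PowerSeries.coeff (R := ExtM) n).toAddMonoidHom.comp (hs D).toRingHom.toAddMonoidHom

theorem hs_ι (D : ℕ → Module.End ℤ M) (v : M) :
    hs D (ExteriorAlgebra.ι ℤ v) = PowerSeries.mk fun n => ExteriorAlgebra.ι ℤ (D n v) :=
  ExteriorAlgebra.lift_ι_apply ℤ _ _ _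

theorem hsCoeff_apply (D : ℕ → Module.End ℤ M) (n : ℕ) (x : ExtM) :
    hsCoeff D n x = PowerSeries.coeff n (hs D x) := rfl

theorem hsCoeff_ι (D : ℕ → Module.End ℤ M) (n : ℕ) (v : M) :
    hsCoeff D n (ExteriorAlgebra.ι ℤ v) = ExteriorAlgebra.ι ℤ (D n v) := by
  rw [hsCoeff_apply, hs_ι, PowerSeries.coeff_mk]

theorem hsCoeff_mul (D : ℕ → Module.End ℤ M) (n : ℕ) (x y : ExtM) :
    hsCoeff D n (x * y) =
      ∑ p ∈ Finset.HasAntidiagonal.antidiagonal n, hsCoeff D p.1 x * hsCoeff D p.2 y := by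
  simp only [hsCoeff_apply, map_mul, PowerSeries.coeff_mul]

theorem hsCoeff_zero (D : ℕ → Module.End ℤ M) (h : D 0 = 1) (x : ExtM) :
    hsCoeff D 0 x = x := by
  induction x using ExteriorAlgebra.induction with
  | algebraMap r =>
    rw [hsCoeff_apply, AlgHom.commutes]
    simp
  | ι v => rw [hsCoeff_ι, h]; rfl
  | mul x y hx hy => rw [hsCoeff_mul]; simp [hx, hy]
  | add x y hx hy => rw [map_add, hx, hy]

/-- The shift `b_i ↦ b_{i+k}` of `M`. -/
def shift (k : ℤ) : Module.End ℤ M := Finsupp.lmapDomain ℤ ℤ (fun i => i + k)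

theorem shift_single (k i : ℤ) : shift k (Finsupp.single i 1) = Finsupp.single (i + k) 1 := by
  simp [shift]

/-- `σ₊(z)`, with `t = z`: the Hasse-Schmidt derivation with `b_j ↦ ∑_{i ≥ 0} b_{j+i} zⁱ`. -/
def sigmaPlusD (i : ℕ) : Module.End ℤ M := shift i

/-- `σ₋(z)`, with `t = z⁻¹`: the Hasse-Schmidt derivation with `b_j ↦ ∑_{i ≥ 0} b_{j-i} z⁻ⁱ`. -/
def sigmaMinusD (i : ℕ) : Module.End ℤ M := shift (-i)

/-- `σ̄₋(z)`, with `t = z⁻¹`: the Hasse-Schmidt derivation with `b_j ↦ b_j - b_{j-1} z⁻¹`. -/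
def sigmaBarMinusD (i : ℕ) : Module.End ℤ M :=
  if i = 0 then 1 else if i = 1 then -shift (-1) else 0

/-! ### Extension of the Schubert derivations to the Fock space -/

theorem hsCoeff_plus_b_mul_b (m : ℤ) (n : ℕ) (x : ExtM) :
    hsCoeff sigmaPlusD n (x * b m * b (m - 1)) =
      hsCoeff sigmaPlusD n (x * b m) * b (m - 1) := by
  have e : hs sigmaPlusD (b (m - 1)) =
      PowerSeries.C (b (m - 1)) + hs sigmaPlusD (b m) * PowerSeries.X := by
    simp only [b, hs_ι]
    ext n
    rcases n with _ | n
    · simp [sigmaPlusD, shift_single]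
    · simp only [sigmaPlusD, PowerSeries.coeff_mk, map_add, PowerSeries.coeff_succ_mul_X,
        shift_single, PowerSeries.coeff_C]
      simp
  have e2 : hs sigmaPlusD (b m) * hs sigmaPlusD (b m) = 0 := by
    rw [← map_mul, b_mul_self, map_zero]
  have e3 : hs sigmaPlusD (x * b m) * hs sigmaPlusD (b m) = 0 := by
    rw [map_mul, mul_assoc, e2, mul_zero]
  rw [hsCoeff_apply, hsCoeff_apply, map_mul (hs sigmaPlusD) (x * b m), e, mul_add, ← mul_assoc,
    e3, zero_mul, add_zero, PowerSeries.coeff_mul_C]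

/-- The coefficient `σ_n` (`n ≥ 0`) of `σ₊(z)` on `F`, given by
`σ₊(z)(u ∧ [b]_m) = σ₊(z)(u) ∧ σ₊(z)(b_m) ∧ [b]_{m-1}`. -/
def sigmaPlusF (n : ℕ) : Module.End ℤ F :=
  (liftF (fun m => ((smulAddHom ExtM F).flip (vac (m - 1))).comp
      ((hsCoeff sigmaPlusD n).comp (AddMonoidHom.mulRight (b m))))
    (by
      intro m x
      change hsCoeff sigmaPlusD n (x * b m * b (m - 1)) • vac (m - 1 - 1) =
        hsCoeff sigmaPlusD n (x * b m) • vac (m - 1)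
      rw [hsCoeff_plus_b_mul_b, ← smul_smul, b_smul_vac_pred])
    (by
      intro m x
      change hsCoeff sigmaPlusD n (x * b m * b m) • vac (m - 1) = 0
      rw [mul_assoc, b_mul_self, mul_zero, map_zero, zero_smul])).toIntLinearMap

theorem sigmaPlusF_smul_vac (n : ℕ) (u : ExtM) (m : ℤ) :
    sigmaPlusF n (u • vac m) = hsCoeff sigmaPlusD n (u * b m) • vac (m - 1) := by
  rw [sigmaPlusF, AddMonoidHom.coe_toIntLinearMap, liftF_smul_vac]
  rfl

/-- The extension to `F` of the coefficients of a Hasse-Schmidt derivation `𝒟(z)` which lowers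
indices (all `D_r b_m`, `r ≥ 1`, are killed by wedging with `[b]_{m-1}`), given by
`𝒟(z)(u ∧ [b]_m) = 𝒟(z)(u) ∧ [b]_m`. -/
def lowerF (D : ℕ → Module.End ℤ M) (h0 : D 0 = 1)
    (h : ∀ m : ℤ, ∀ r : ℕ, ExteriorAlgebra.ι ℤ (D (r + 1) (Finsupp.single m 1)) • vac (m - 1) = 0)
    (h' : ∀ m : ℤ, ∀ r : ℕ, ExteriorAlgebra.ι ℤ (D r (Finsupp.single m 1)) • vac m = 0)
    (n : ℕ) : Module.End ℤ F :=
  (liftF (fun m => ((smulAddHom ExtM F).flip (vac m)).comp (hsCoeff D n))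
    (by
      intro m x
      change hsCoeff D n (x * b m) • vac (m - 1) = hsCoeff D n x • vac m
      rw [hsCoeff_mul, Finset.sum_smul, Finset.sum_eq_single (n, 0)]
      · rw [hsCoeff_zero D h0, ← smul_smul, b_smul_vac_pred]
      · rintro ⟨p, q⟩ hpq hne
        rcases q with _ | q
        · exact absurd (by simpa using hpq) hne
        · rw [← smul_smul, b, hsCoeff_ι, h, smul_zero]
      · intro hn; exact absurd (by simp) hn)
    (by
      intro m x
      change hsCoeff D n (x * b m) • vac m = 0
      rw [hsCoeff_mul, Finset.sum_smul]
      refine Finset.sum_eq_zero fun p _ => ?_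
      rw [← smul_smul, b, hsCoeff_ι, h', smul_zero])).toIntLinearMap

/-- The coefficient of `z⁻ⁿ` of `σ₋(z)` on `F`: `σ₋(z)(u ∧ [b]_m) = σ₋(z)(u) ∧ [b]_m`. -/
def sigmaMinusF (n : ℕ) : Module.End ℤ F :=
  lowerF sigmaMinusD (by simp only [sigmaMinusD, shift, Nat.cast_zero, neg_zero, add_zero]; exact Finsupp.lmapDomain_id ℤ ℤ)
    (by
      intro m r
      rw [sigmaMinusD, shift_single]
      exact b_smul_vac_of_le (by push_cast; lia))
    (by
      intro m r
      rw [sigmaMinusD, shift_single]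
      exact b_smul_vac_of_le (by lia)) n

theorem sigmaMinusF_smul_vac (n : ℕ) (u : ExtM) (m : ℤ) :
    sigmaMinusF n (u • vac m) = hsCoeff sigmaMinusD n u • vac m := by
  rw [sigmaMinusF, lowerF, AddMonoidHom.coe_toIntLinearMap, liftF_smul_vac]
  rfl

/-- The coefficient of `z⁻ⁿ` of `σ̄₋(z)` on `F`: `σ̄₋(z)(u ∧ [b]_m) = σ̄₋(z)(u) ∧ [b]_m`. -/
def sigmaBarMinusF (n : ℕ) : Module.End ℤ F :=
  lowerF sigmaBarMinusD (by simp [sigmaBarMinusD])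
    (by
      intro m r
      rcases r with _ | r
      · have : b (m + -1) • vac (m - 1) = 0 := b_smul_vac_of_le (by lia)
        simpa [sigmaBarMinusD, shift_single, b] using this
      · simp [sigmaBarMinusD])
    (by
      intro m r
      rcases r with _ | _ | r
      · simpa [sigmaBarMinusD, b] using b_smul_vac_self m
      · have : b (m + -1) • vac m = 0 := b_smul_vac_of_le (by lia)
        simpa [sigmaBarMinusD, shift_single, b] using this
      · simp [sigmaBarMinusD]) n

theorem sigmaBarMinusF_smul_vac (n : ℕ) (u : ExtM) (m : ℤ) :
    sigmaBarMinusF n (u • vac m) = hsCoeff sigmaBarMinusD n u • vac m := by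
  rw [sigmaBarMinusF, lowerF, AddMonoidHom.coe_toIntLinearMap, liftF_smul_vac]
  rfl

/-! ### The action of the elementary matrices on the Fock space -/

/-- For an endomorphism `A` of `M`, the derivation `δ(A)` of `⋀M` extending `A`: it is the
coefficient of `t` in the algebra homomorphism `⋀M → (⋀M)[[t]]` with `v ↦ v + A(v) t`. -/
def delta (A : Module.End ℤ M) : ExtM →+ ExtM :=
  hsCoeff (fun n => if n = 0 then 1 else if n = 1 then A else 0) 1

theorem delta_ι (A : Module.End ℤ M) (v : M) :
    delta A (ExteriorAlgebra.ι ℤ v) = ExteriorAlgebra.ι ℤ (A v) := by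
  rw [delta, hsCoeff_ι]; simp

theorem delta_mul (A : Module.End ℤ M) (x y : ExtM) :
    delta A (x * y) = delta A x * y + x * delta A y := by
  rw [delta, hsCoeff_mul, Finset.Nat.sum_antidiagonal_succ]
  simp [hsCoeff_zero, add_comm]

/-- The elementary matrix `ℬ_{ij} = b_i ⊗ β_j`, that is, `b_j ↦ b_i` and `b_k ↦ 0` for
`k ≠ j`. -/
def elemMat (i j : ℤ) : Module.End ℤ M :=
  (Finsupp.lsingle i).comp (Finsupp.lapply j)

theorem elemMat_single_self (i j : ℤ) :
    elemMat i j (Finsupp.single j 1) = Finsupp.single i 1 := by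
  simp [elemMat]

theorem elemMat_single_of_ne (i : ℤ) {j k : ℤ} (h : k ≠ j) :
    elemMat i j (Finsupp.single k 1) = 0 := by
  simp [elemMat, Finsupp.single_eq_of_ne h.symm]

/-- `descend n r = b_n ∧ b_{n-1} ∧ ⋯ ∧ b_{n-r+1}`, so that
`[b]_n = descend n r ∧ [b]_{n-r}`. -/
def descend (n : ℤ) : ℕ → ExtM
  | 0 => 1
  | r + 1 => b n * descend (n - 1) r

theorem descend_smul_vac (n : ℤ) (r : ℕ) : descend n r • vac (n - r) = vac n := by
  induction r generalizing n with
  | zero => simp [descend]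
  | succ r ih =>
    have := ih (n - 1)
    rw [descend, ← smul_smul]
    rw [show n - ((r + 1 : ℕ) : ℤ) = n - 1 - (r : ℤ) by push_cast; ring, this, b_smul_vac_pred]

/-- The number of factors that must be split off `[b]_n` to reach `[b]_{n-r}` with
`n - r < j`; it is zero if `n < j`. -/
def splitLen (j n : ℤ) : ℕ := (n - j + 1).toNat

/-- The action of `ℬ_{ij}` on `F`:  one has `δ(ℬ_{ij})(u ∧ [b]_n) = δ(ℬ_{ij})(u) ∧ [b]_n` when
`n < j`, and every `u ∧ [b]_n` is brought to this form by
`[b]_n = b_n ∧ ⋯ ∧ b_j ∧ [b]_{j-1}`. -/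
def deltaF (i j : ℤ) : Module.End ℤ F :=
  (liftF (fun n => ((smulAddHom ExtM F).flip (vac (n - splitLen j n))).comp
      ((delta (elemMat i j)).comp (AddMonoidHom.mulRight (descend n (splitLen j n)))))
    (by
      intro m x
      change delta (elemMat i j) (x * b m * descend (m - 1) (splitLen j (m - 1))) •
          vac (m - 1 - splitLen j (m - 1)) =
        delta (elemMat i j) (x * descend m (splitLen j m)) • vac (m - splitLen j m)
      rcases lt_or_ge m j with h | h
      · have e1 : splitLen j m = 0 := by simp only [splitLen]; lia
        have e2 : splitLen j (m - 1) = 0 := by simp only [splitLen]; lia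
        rw [e1, e2]
        simp only [descend, mul_one, Nat.cast_zero, sub_zero]
        rw [delta_mul, b, delta_ι, elemMat_single_of_ne i h.ne, map_zero, mul_zero, add_zero,
          ← smul_smul]
        exact congrArg _ (b_smul_vac_pred m)
      · have e1 : splitLen j m = splitLen j (m - 1) + 1 := by simp only [splitLen]; lia
        rw [e1, descend, mul_assoc]
        congr 2
        push_cast; ring)
    (by
      intro m x
      change delta (elemMat i j) (x * b m * descend m (splitLen j m)) •
        vac (m - splitLen j m) = 0
      rcases lt_or_ge m j with h | h
      · have e1 : splitLen j m = 0 := by simp only [splitLen]; lia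
        rw [e1]
        simp only [descend, mul_one, Nat.cast_zero, sub_zero]
        rw [delta_mul, b, delta_ι, elemMat_single_of_ne i h.ne, map_zero, mul_zero, add_zero,
          ← smul_smul]
        have := b_smul_vac_self m
        rw [b] at this
        rw [this, smul_zero]
      · have e1 : splitLen j m = splitLen j (m - 1) + 1 := by simp only [splitLen]; lia
        rw [e1, descend, mul_assoc, ← mul_assoc (b m), b_mul_self, zero_mul, mul_zero, map_zero,
          zero_smul])).toIntLinearMap

theorem deltaF_smul_vac (i : ℤ) {j n : ℤ} (h : n < j) (u : ExtM) :
    deltaF i j (u • vac n) = delta (elemMat i j) u • vac n := by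
  have e1 : splitLen j n = 0 := by simp only [splitLen]; lia
  rw [deltaF, AddMonoidHom.coe_toIntLinearMap, liftF_smul_vac]
  change delta (elemMat i j) (u * descend n (splitLen j n)) • vac (n - splitLen j n) = _
  rw [e1]
  simp [descend]

/-! ### The boson-fermion correspondence -/

theorem sigmaPlusF_b_smul (n : ℕ) (k : ℤ) (φ : F) :
    sigmaPlusF n (b k • φ) =
      ∑ p ∈ Finset.HasAntidiagonal.antidiagonal n, b (k + p.1) • sigmaPlusF p.2 φ := by
  induction φ using F_induction with
  | h0 => simp
  | hadd x y hx hy => simp only [smul_add, map_add, hx, hy, Finset.sum_add_distrib]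
  | h u m =>
    rw [smul_smul, sigmaPlusF_smul_vac, mul_assoc, hsCoeff_mul, Finset.sum_smul]
    refine Finset.sum_congr rfl fun p _ => ?_
    rw [sigmaPlusF_smul_vac, smul_smul]
    congr 2
    rw [b, hsCoeff_ι, sigmaPlusD, shift_single]; rfl

theorem sigmaPlusF_vac (n : ℕ) (m : ℤ) : sigmaPlusF n (vac m) = b (m + n) • vac (m - 1) := by
  have := sigmaPlusF_smul_vac n 1 m
  rw [one_smul, one_mul] at this
  rw [this, b, hsCoeff_ι, sigmaPlusD, shift_single]; rfl

theorem sigmaPlusF_zero : sigmaPlusF 0 = 1 := by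
  ext φ
  induction φ using F_induction with
  | h0 => simp
  | hadd x y hx hy => rw [map_add, hx, hy, map_add]
  | h u m =>
    rw [sigmaPlusF_smul_vac, hsCoeff_zero, ← smul_smul, b_smul_vac_pred]; rfl
    simp only [sigmaPlusD, shift, Nat.cast_zero, add_zero]
    exact Finsupp.lmapDomain_id ℤ ℤ

theorem sigmaPlusF_comm_vac_aux (i j : ℕ) (hij : i ≤ j) (m : ℤ) :
    sigmaPlusF i (sigmaPlusF j (vac m)) = sigmaPlusF j (sigmaPlusF i (vac m)) := by
  have key : ∀ i j : ℕ, sigmaPlusF i (sigmaPlusF j (vac m)) =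
      (∑ k ∈ Finset.Ico (m + j) (m + i + j + 1), b k * b (2 * m - 1 + i + j - k)) •
        vac (m - 2) := by
    intro i j
    rw [sigmaPlusF_vac, sigmaPlusF_b_smul, Finset.sum_smul]
    refine Finset.sum_bij (fun p _ => m + j + (p.1 : ℤ)) ?_ ?_ ?_ ?_
    · intro p hp
      rw [Finset.HasAntidiagonal.mem_antidiagonal] at hp
      rw [Finset.mem_Ico]; lia
    · rintro ⟨p, q⟩ hp ⟨p', q'⟩ hp' h
      rw [Finset.HasAntidiagonal.mem_antidiagonal] at hp hp'
      simp only [Prod.mk.injEq]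
      simp only at h hp hp'
      lia
    · intro k hk
      rw [Finset.mem_Ico] at hk
      refine ⟨((k - m - j).toNat, i - (k - m - j).toNat), ?_, ?_⟩
      · rw [Finset.HasAntidiagonal.mem_antidiagonal]; lia
      · simp only; lia
    · rintro ⟨p, q⟩ hp
      rw [Finset.HasAntidiagonal.mem_antidiagonal] at hp
      simp only at hp
      rw [sigmaPlusF_vac, smul_smul, show m - 1 - 1 = m - 2 by ring]
      congr 3
      simp only
      lia
  rw [key, key]
  congr 1
  rw [← Finset.Ico_union_Ico_eq_Ico (show m + (i : ℤ) ≤ m + j by lia)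
    (show m + (j : ℤ) ≤ m + j + i + 1 by lia),
    Finset.sum_union (Finset.Ico_disjoint_Ico_consecutive _ _ _)]
  have hz : ∑ k ∈ Finset.Ico (m + (i : ℤ)) (m + j), b k * b (2 * m - 1 + j + i - k) = 0 := by
    refine Finset.sum_involution (fun k _ => 2 * m - 1 + j + i - k) ?_ ?_ ?_ ?_
    · intro k _
      rw [sub_sub_cancel]
      exact ExteriorAlgebra.ι_add_mul_swap _ _
    · intro k _ hne hk
      rw [hk, b_mul_self] at hne
      exact hne rfl
    · intro k hk
      rw [Finset.mem_Ico] at hk ⊢; lia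
    · intro k _; ring
  rw [hz, zero_add, show m + (j : ℤ) + i + 1 = m + i + j + 1 by ring,
    show 2 * m - 1 + (j : ℤ) + i = 2 * m - 1 + i + j by ring]

theorem sigmaPlusF_comm (i j : ℕ) (φ : F) :
    sigmaPlusF i (sigmaPlusF j φ) = sigmaPlusF j (sigmaPlusF i φ) := by
  have hb : ∀ (k : ℤ) (φ : F),
      (∀ i j, sigmaPlusF i (sigmaPlusF j φ) = sigmaPlusF j (sigmaPlusF i φ)) →
      ∀ i j, sigmaPlusF i (sigmaPlusF j (b k • φ)) = sigmaPlusF j (sigmaPlusF i (b k • φ)) := by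
    intro k φ h i j
    simp only [sigmaPlusF_b_smul, map_sum]
    rw [Finset.sum_comm]
    refine Finset.sum_congr rfl fun p _ => Finset.sum_congr rfl fun q _ => ?_
    rw [h, add_right_comm]
  have hu : ∀ (u : ExtM) (φ : F),
      (∀ i j, sigmaPlusF i (sigmaPlusF j φ) = sigmaPlusF j (sigmaPlusF i φ)) →
      ∀ i j, sigmaPlusF i (sigmaPlusF j (u • φ)) = sigmaPlusF j (sigmaPlusF i (u • φ)) := by
    intro u
    induction u using ExteriorAlgebra.induction with
    | algebraMap r =>
      intro φ h i j
      have e : (algebraMap ℤ ExtM r) • φ = r • φ := by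
        rw [Algebra.algebraMap_eq_smul_one, smul_assoc, one_smul]
      rw [e]
      simp only [map_zsmul, h i j]
    | ι v =>
      intro φ h
      induction v using Finsupp.induction_linear with
      | zero => intro i j; simp
      | add x y hx hy => intro i j; simp only [map_add, add_smul, hx i j, hy i j]
      | single k c =>
        intro i j
        have e : ExteriorAlgebra.ι ℤ (Finsupp.single k c) • φ = c • (b k • φ) := by
          rw [← smul_assoc, b, ← map_zsmul, Finsupp.smul_single, smul_eq_mul, mul_one]
        rw [e]
        simp only [map_zsmul, hb k φ h i j]
    | mul x y hx hy =>
      intro φ h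
      rw [mul_smul]
      exact hx _ (hy _ h)
    | add x y hx hy => intro φ h i j; simp only [map_add, add_smul, hx φ h i j, hy φ h i j]
  induction φ using F_induction with
  | h0 => simp
  | hadd x y hx hy => simp only [map_add, hx, hy]
  | h u m =>
    refine hu u (vac m) (fun i j => ?_) i j
    rcases le_total i j with h | h
    · exact sigmaPlusF_comm_vac_aux i j h m
    · exact (sigmaPlusF_comm_vac_aux j i h m).symm

/-- The polynomial ring `B = ℤ[e_1, e_2, …]`; the variable with index `k` is `e_{k+1}`. -/
abbrev B : Type := MvPolynomial ℕ ℤ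

/-- `E(z) = 1 + ∑_{j ≥ 1} (-1)^j e_j z^j`. -/
def E : PowerSeries B :=
  PowerSeries.mk fun n => if n = 0 then 1 else (-1) ^ n * MvPolynomial.X (n - 1)

/-- `H(z) = 1 / E(z)`. -/
def H : PowerSeries B := PowerSeries.invOfUnit E 1

theorem E_mul_H : E * H = 1 := PowerSeries.mul_invOfUnit E 1 (by simp [E])

/-- The coefficient `h_n` of `z^n` in `H(z)`, which is zero for `n < 0`. -/
def h (n : ℤ) : B := if 0 ≤ n then PowerSeries.coeff n.toNat H else 0

/-- The algebra of endomorphisms of `F` generated by the commuting operators `σ_n`, `n ≥ 0`. -/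
abbrev sigmaAlg : Subalgebra ℤ (Module.End ℤ F) := Algebra.adjoin ℤ (Set.range sigmaPlusF)

instance sigmaAlgCommRing : CommRing sigmaAlg :=
  { (inferInstance : Ring sigmaAlg) with
    mul_comm := (Algebra.isMulCommutative_adjoin ℤ (s := Set.range sigmaPlusF) (by
      rintro _ ⟨i, rfl⟩ _ ⟨j, rfl⟩
      exact LinearMap.ext fun φ => sigmaPlusF_comm i j φ)).is_comm.comm }

/-- The series `σ₊(z) = ∑ σ_n z^n` with coefficients in `sigmaAlg`. -/
def sigmaSeries : PowerSeries sigmaAlg :=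
  PowerSeries.mk fun n => ⟨sigmaPlusF n, Algebra.subset_adjoin ⟨n, rfl⟩⟩

/-- The ring homomorphism `B → sigmaAlg` which maps `E(z)` to the inverse of `σ₊(z)`, that is,
`h_n` to `σ_n`. -/
def actHom : B →+* sigmaAlg :=
  MvPolynomial.eval₂Hom (Int.castRingHom sigmaAlg) fun k =>
    (-1) ^ (k + 1) * PowerSeries.coeff (k + 1) (PowerSeries.invOfUnit sigmaSeries 1)

/-- The `B`-module structure of `F`, in which `h_n` acts as `σ_n`. -/
def act (f : B) : Module.End ℤ F := (actHom f : Module.End ℤ F)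

theorem act_h (n : ℕ) : act (h n) = sigmaPlusF n := by
  have h0 : PowerSeries.constantCoeff sigmaSeries = ((1 : sigmaAlgˣ) : sigmaAlg) := by
    rw [← PowerSeries.coeff_zero_eq_constantCoeff_apply, sigmaSeries, PowerSeries.coeff_mk]
    exact Subtype.ext sigmaPlusF_zero
  have hE : PowerSeries.map actHom E = PowerSeries.invOfUnit sigmaSeries 1 := by
    ext1 n
    rw [PowerSeries.coeff_map, E, PowerSeries.coeff_mk]
    rcases n with _ | n
    · rw [if_pos rfl, map_one, PowerSeries.coeff_zero_eq_constantCoeff_apply,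
        PowerSeries.constantCoeff_invOfUnit]
      simp
    · rw [if_neg (Nat.succ_ne_zero n), map_mul, actHom, MvPolynomial.eval₂Hom_X',
        map_pow, map_neg, map_one, Nat.add_sub_cancel, ← mul_assoc, ← mul_pow]
      simp
  have hH : PowerSeries.map actHom H = sigmaSeries := by
    have e1 : PowerSeries.map actHom E * PowerSeries.map actHom H = 1 := by
      rw [← map_mul, E_mul_H, map_one]
    have e2 := PowerSeries.mul_invOfUnit sigmaSeries 1 h0
    rw [hE] at e1
    calc PowerSeries.map actHom H
        = (sigmaSeries * PowerSeries.invOfUnit sigmaSeries 1) * PowerSeries.map actHom H := by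
          rw [e2, one_mul]
      _ = sigmaSeries := by rw [mul_assoc, e1, mul_one]
  have := congrArg (PowerSeries.coeff n) hH
  rw [PowerSeries.coeff_map, sigmaSeries, PowerSeries.coeff_mk] at this
  rw [act, h, if_pos (Int.natCast_nonneg n), Int.toNat_natCast, this]

/-- The map `f ↦ f · [b]_m` from `B` to the Fock space. -/
def bf (m : ℤ) (f : B) : F := act f (vac m)

/-- The Schur determinant `Δ_λ(H) = det(h_{λ_j - j + i})_{1 ≤ i, j ≤ r}` of a partition `λ` with
parts `λ_1 ≥ λ_2 ≥ ⋯`, given by its Young diagram (`λ_{k+1}` is the length of the row with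
index `k`). -/
def schurDet (lam : YoungDiagram) (r : ℕ) : B :=
  Matrix.det (Matrix.of fun i j : Fin r => h ((lam.rowLen j : ℤ) - (j : ℤ) + (i : ℤ)))

/-- `[b]_{m+λ} = b_{m+λ_1} ∧ b_{m-1+λ_2} ∧ ⋯ ∧ b_{m-r+1+λ_r} ∧ [b]_{m-r}`, where `r` is at least
the length of `λ`. -/
def bLam (m : ℤ) (lam : YoungDiagram) (r : ℕ) : F :=
  (List.ofFn fun k : Fin r => b (m - (k : ℤ) + (lam.rowLen k : ℤ))).prod • vac (m - r)

/-- The fermionic Fock space `F_m` of charge `m`, spanned by all `[b]_{m+λ}`; the length of `λ`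
is `lam.colLen 0`. -/
def Fock (m : ℤ) : Submodule ℤ F :=
  Submodule.span ℤ {φ | ∃ (lam : YoungDiagram) (r : ℕ), lam.colLen 0 ≤ r ∧ φ = bLam m lam r}

/-! ### Operators transported to `B`, and the vertex operator -/

/-- `σ₋(z) : B → B[z⁻¹]`, defined through `(σ₋(z) f) [b]_0 = σ₋(z) (f [b]_0)`; the variable of
the polynomial is `z⁻¹`. -/
def sigmaMinusB (f : B) : Polynomial B :=
  Classical.epsilon fun P : Polynomial B => ∀ n, bf 0 (P.coeff n) = sigmaMinusF n (bf 0 f)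

/-- `σ̄₋(z) : B → B[z⁻¹]`, defined through `(σ̄₋(z) f) [b]_0 = σ̄₋(z) (f [b]_0)`; the variable of
the polynomial is `z⁻¹`. -/
def sigmaBarMinusB (f : B) : Polynomial B :=
  Classical.epsilon fun P : Polynomial B => ∀ n, bf 0 (P.coeff n) = sigmaBarMinusF n (bf 0 f)

/-- The action of `ℬ_{ij}` on `B` in charge `m`, that is, the coefficient of `z^i w^{-j}` in
`ℬ^{(m)}(z,w)`, defined through `(ℬ^{(m)}_{ij} f) [b]_m = δ_m(ℬ_{ij}) (f [b]_m)`. -/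
def calB (m i j : ℤ) (f : B) : B :=
  Classical.epsilon fun g : B => bf m g = deltaF i j (bf m f)

/-- The ring `B((z))((w))`: the expansion `i_{z,w}` takes place in this ring. -/
abbrev L : Type := LaurentSeries (LaurentSeries B)

/-- The monomial `c z^p w^q`. -/
def monom (p q : ℤ) (c : B) : L := HahnSeries.single q (HahnSeries.single p c)

/-- A power series in one variable, taken at `z`. -/
def inZ (f : PowerSeries B) : L := HahnSeries.C (HahnSeries.ofPowerSeries ℤ B f)

/-- A power series in one variable, taken at `w`. -/
def inW (f : PowerSeries B) : L :=
  HahnSeries.ofPowerSeries ℤ (LaurentSeries B) (PowerSeries.map HahnSeries.C f)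

/-- `i_{z,w} (z / (z - w)) = ∑_{k ≥ 0} (w/z)^k`. -/
def iExp : L :=
  HahnSeries.ofPowerSeries ℤ (LaurentSeries B)
    (PowerSeries.mk fun k => HahnSeries.single (-(k : ℤ)) 1)

theorem sub_mul_iExp : (monom 1 0 1 - monom 0 1 1) * iExp = monom 1 0 1 := by
  have e : (PowerSeries.C (HahnSeries.single (1 : ℤ) (1 : B)) - PowerSeries.X) *
      PowerSeries.mk (fun k : ℕ => HahnSeries.single (-(k : ℤ)) (1 : B)) =
      PowerSeries.C (HahnSeries.single (1 : ℤ) (1 : B)) := by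
    ext1 n
    rw [sub_mul, map_sub, PowerSeries.coeff_C_mul, PowerSeries.coeff_mk,
      HahnSeries.single_mul_single, PowerSeries.coeff_C]
    rcases n with _ | n
    · simp
    · rw [PowerSeries.coeff_succ_X_mul, PowerSeries.coeff_mk, if_neg (Nat.succ_ne_zero n)]
      rw [show (1 : ℤ) + -((n + 1 : ℕ) : ℤ) = -(n : ℤ) by push_cast; ring, one_mul, sub_self]
  have e2 := congrArg (HahnSeries.ofPowerSeries ℤ (LaurentSeries B)) e
  rw [map_mul, map_sub, HahnSeries.ofPowerSeries_C, HahnSeries.ofPowerSeries_X] at e2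
  exact e2

/-- `σ̄₋(z) σ₋(w) f`, an element of `B[z⁻¹, w⁻¹]`. -/
def sigmaSigma (f : B) : L :=
  (sigmaMinusB f).sum fun q g => (sigmaBarMinusB g).sum fun p c => monom (-(p : ℤ)) (-(q : ℤ)) c

/-- The vertex operator `Γ(z,w) = (E(w)/E(z)) σ̄₋(z) σ₋(w)`. -/
def Gam (f : B) : L := inW E * inZ H * sigmaSigma f

end DJKM

namespace DJKM

open Polynomial (X C)

/-! ### Coefficients of power series with integer index -/

/-! The proof builds a second model of the Fock space, the direct sum `V` of one copy of `B` for
each charge, and makes all operators explicit there.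

On `B`, the lowering derivations are introduced independently as ring homomorphisms: `sBar`
multiplies `H(w)` by `1 - w/z`, and `sMinus` multiplies `E(z)` by `1 - z/w`. The coefficients of
`E(z)⁻¹ σ̄₋(z)` and `E(w) σ₋(w)` are then creation and annihilation operators. They satisfy Clifford
relations (`creation_creation`, `annihilation_creation`), which follow from `E H = 1`, from the
commutation of `sMinus` and `sBar`, and from `σ₋(t) σ̄₋(t) = 1`.

By the first relation the exterior algebra acts on `V`, with `b_k` acting from charge `m` to charge
`m + 1` as `creation (k - m - 1)`. The universal property of `F` yields `toV : F → V`, sending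
`[b]_m` to `1` in charge `m`. It turns `σ_n` into multiplication by `h_n`, so `toV (f [b]_m)` is `f`
in charge `m`; this is the injectivity of `f ↦ f [b]_m`. Conversely `b_smul_bf` computes `b_k ∧ f
[b]_m`, and it follows that `toV` is injective (`ofV_toV`).

An identity between operators on `F` may now be checked in `V`, on vacua of low charge and on how
both sides commute with the `b_k`. This identifies `σ₋` and `σ̄₋` with `sMinus` and `sBar`, and
`δ(ℬ_ij)` in charge `m` with `creation (i - m) ∘ annihilation (m - j)`. Hence `ℬ^{(m)}(z,w)` is `z^m
w^{-m} E(z)⁻¹ σ̄₋(z) E(w) σ₋(w)`. Moving `σ̄₋(z)` past `E(w)` produces the factor `1/(1 - w/z)`,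
which is the vertex formula (`coeff_vertex`).

The determinant formula comes from iterating creation operators on `1`: each one adds a column to
the determinant (`creation_det`). The image of `B` is `F_m` because `F_m` is stable under the `σ_n`,
which generate the action, and because each spanning vector is a determinant applied to `[b]_m`. -/

/-- The coefficient of `t^n` in a power series, extended by zero to `n < 0`. -/
def zcoeff {R : Type} [CommRing R] (A : PowerSeries R) (n : ℤ) : R :=
  if 0 ≤ n then PowerSeries.coeff n.toNat A else 0

theorem zcoeff_natCast {R : Type} [CommRing R] (A : PowerSeries R) (n : ℕ) :
    zcoeff A n = PowerSeries.coeff n A := by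
  simp [zcoeff]

theorem zcoeff_of_neg {R : Type} [CommRing R] (A : PowerSeries R) {n : ℤ} (hn : n < 0) :
    zcoeff A n = 0 := by
  rw [zcoeff, if_neg (not_le.2 hn)]

theorem zcoeff_map {R S : Type} [CommRing R] [CommRing S] (ρ : R →+* S) (A : PowerSeries R)
    (n : ℤ) : zcoeff (PowerSeries.map ρ A) n = ρ (zcoeff A n) := by
  unfold zcoeff; split_ifs <;> simp

theorem zcoeff_mul_one_sub {R : Type} [CommRing R] (A : PowerSeries R) (t : R) (n : ℤ) :
    zcoeff (A * (1 - PowerSeries.C t * PowerSeries.X)) n = zcoeff A n - t * zcoeff A (n - 1) := by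
  rcases lt_or_ge n 0 with hn | hn
  · rw [zcoeff_of_neg _ hn, zcoeff_of_neg _ hn, zcoeff_of_neg _ (by lia)]; simp
  · lift n to ℕ using hn
    rw [zcoeff_natCast, zcoeff_natCast, mul_sub, mul_one, map_sub,
      mul_left_comm, PowerSeries.coeff_C_mul]
    rcases n with _ | n
    · rw [zcoeff_of_neg _ (by simp)]; simp
    · rw [PowerSeries.coeff_succ_mul_X]
      rw [show ((n + 1 : ℕ) : ℤ) - 1 = (n : ℤ) by push_cast; ring, zcoeff_natCast]

/-- The signed elementary symmetric function `(-1)^n e_n`, the coefficient of `z^n` in `E(z)`. -/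
def e (n : ℤ) : B := zcoeff E n

theorem h_eq_zcoeff (n : ℤ) : h n = zcoeff H n := rfl

theorem h_of_neg {n : ℤ} (hn : n < 0) : h n = 0 := zcoeff_of_neg _ hn

theorem e_of_neg {n : ℤ} (hn : n < 0) : e n = 0 := zcoeff_of_neg _ hn

theorem constantCoeff_E : PowerSeries.constantCoeff E = 1 := by simp [E]

theorem constantCoeff_map_E {R : Type} [CommRing R] (ρ : B →+* R) :
    PowerSeries.constantCoeff (PowerSeries.map ρ E) = 1 := by
  rw [← PowerSeries.coeff_zero_eq_constantCoeff_apply, PowerSeries.coeff_map,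
    PowerSeries.coeff_zero_eq_constantCoeff_apply, constantCoeff_E, map_one]

theorem h_zero : h 0 = 1 := by
  have := congrArg PowerSeries.constantCoeff E_mul_H
  rw [map_mul, constantCoeff_E, one_mul, map_one] at this
  simpa [h] using this

/-- `E(z) H(z) = 1` in coefficients. -/
theorem sum_e_mul_h (c d : ℤ) (N : ℕ) (hc : c ≤ N) (hd : d ≤ N) :
    ∑ k ∈ Finset.Ico (-(N : ℤ)) (N + 1), e (c + k) * h (d - k) = if c + d = 0 then 1 else 0 := by
  have key : ∀ n : ℕ, ∑ p ∈ Finset.HasAntidiagonal.antidiagonal n, e p.1 * h p.2 = if n = 0 then 1 else 0 := by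
    intro n
    have := congrArg (PowerSeries.coeff n) E_mul_H
    rw [PowerSeries.coeff_mul, PowerSeries.coeff_one] at this
    rw [← this]
    exact Finset.sum_congr rfl fun p _ => by rw [e, h_eq_zcoeff, zcoeff_natCast, zcoeff_natCast]
  rcases lt_or_ge (c + d) 0 with hn | hn
  · rw [if_neg hn.ne]
    refine Finset.sum_eq_zero fun k _ => ?_
    rcases lt_or_ge (c + k) 0 with h1 | h1
    · rw [e_of_neg h1, zero_mul]
    · rw [h_of_neg (n := d - k) (by lia), mul_zero]
  · obtain ⟨n, hn'⟩ := Int.eq_ofNat_of_zero_le hn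
    have hk := key n
    rw [if_congr (show c + d = 0 ↔ n = 0 by lia) rfl rfl, ← hk]
    symm
    -- A nonzero term has `-c ≤ k ≤ d`, so it lies in the window, and it corresponds to the
    -- antidiagonal pair `(c + k, d - k)`.
    refine Finset.sum_bij_ne_zero (fun p _ _ => (p.1 : ℤ) - c) ?_ ?_ ?_ ?_
    · rintro ⟨p, q⟩ hp _
      rw [Finset.HasAntidiagonal.mem_antidiagonal] at hp
      rw [Finset.mem_Ico]
      simp only at hp ⊢
      lia
    · rintro ⟨p, q⟩ hp _ ⟨p', q'⟩ hp' _ heq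
      rw [Finset.HasAntidiagonal.mem_antidiagonal] at hp hp'
      simp only [Prod.mk.injEq] at hp hp' heq ⊢
      lia
    · intro k _ hne
      have h1 : 0 ≤ c + k := by
        by_contra hlt
        rw [e_of_neg (by lia), zero_mul] at hne
        exact hne rfl
      have h2 : 0 ≤ d - k := by
        by_contra hlt
        rw [h_of_neg (by lia), mul_zero] at hne
        exact hne rfl
      refine ⟨((c + k).toNat, (d - k).toNat), ?_, ?_, ?_⟩
      · rw [Finset.HasAntidiagonal.mem_antidiagonal]; simp only; lia
      · rw [Int.toNat_of_nonneg h1, Int.toNat_of_nonneg h2]; exact hne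
      · simp only; lia
    · rintro ⟨p, q⟩ hp _
      rw [Finset.HasAntidiagonal.mem_antidiagonal] at hp
      simp only at hp ⊢
      rw [show c + (p - c) = (p : ℤ) by ring, show d - (p - c) = (q : ℤ) by lia]

/-! ### Ring homomorphisms out of `B` -/

/-- The ring homomorphism with `E(z) ↦ P(z)`, where `P(0) = 1`. -/
def homOfSeries {R : Type} [CommRing R] (P : PowerSeries R) : B →+* R :=
  MvPolynomial.eval₂Hom (Int.castRingHom R) fun k => (-1) ^ (k + 1) * PowerSeries.coeff (k + 1) P

theorem map_homOfSeries {R : Type} [CommRing R] (P : PowerSeries R)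
    (hP : PowerSeries.constantCoeff P = 1) : PowerSeries.map (homOfSeries P) E = P := by
  ext n
  rw [PowerSeries.coeff_map, E, PowerSeries.coeff_mk]
  rcases n with _ | n
  · simp [hP]
  · rw [if_neg (Nat.succ_ne_zero n), map_mul, homOfSeries, MvPolynomial.eval₂Hom_X',
      map_pow, map_neg, map_one, Nat.add_sub_cancel, ← mul_assoc, ← mul_pow]
    simp

theorem hom_ext_E {R : Type} [CommRing R] {ρ τ : B →+* R}
    (H1 : PowerSeries.map ρ E = PowerSeries.map τ E) : ρ = τ := by
  refine MvPolynomial.ringHom_ext (fun n => by simp) fun k => ?_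
  have h1 := congrArg (PowerSeries.coeff (k + 1)) H1
  simp only [PowerSeries.coeff_map, E, PowerSeries.coeff_mk, if_neg (Nat.succ_ne_zero k),
    map_mul, map_pow, map_neg, map_one, Nat.add_sub_cancel] at h1
  have h2 := congrArg (fun x => (-1) ^ (k + 1) * x) h1
  simpa only [← mul_assoc, ← mul_pow, neg_mul_neg, one_mul, one_pow] using h2

theorem hom_ext_H {R : Type} [CommRing R] {ρ τ : B →+* R}
    (H1 : PowerSeries.map ρ H = PowerSeries.map τ H) : ρ = τ := by
  apply hom_ext_E
  have h1 : PowerSeries.map ρ E * PowerSeries.map ρ H = 1 := by rw [← map_mul, E_mul_H, map_one]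
  have h2 : PowerSeries.map τ E * PowerSeries.map τ H = 1 := by rw [← map_mul, E_mul_H, map_one]
  calc PowerSeries.map ρ E = PowerSeries.map ρ E * (PowerSeries.map τ E * PowerSeries.map τ H) := by
        rw [h2, mul_one]
    _ = PowerSeries.map τ E * (PowerSeries.map ρ E * PowerSeries.map ρ H) := by rw [H1]; ring
    _ = _ := by rw [h1, mul_one]

theorem hom_ext_h {R : Type} [CommRing R] {ρ τ : B →+* R} (H1 : ∀ n : ℤ, ρ (h n) = τ (h n)) :
    ρ = τ := by
  apply hom_ext_H
  ext n
  simpa [h_eq_zcoeff, zcoeff_natCast] using H1 n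

/-- The `h_n` generate `B` as a ring, since `E H = 1` and `h_0 = 1` express each `e_n` recursively
through the `h_k` and earlier `e_j`. The multipliers that preserve `P` form a subring, which
therefore is all of `B`. -/
theorem B_induction {P : B → Prop} (h1 : P 1) (hadd : ∀ f g, P f → P g → P (f + g))
    (hneg : ∀ f, P f → P (-f)) (hmul : ∀ (n : ℕ) f, P f → P (h n * f)) (f : B) : P f := by
  have h0 : P 0 := by simpa using hadd _ _ h1 (hneg _ h1)
  let S : Subring B :=
    { carrier := {g | ∀ f, P f → P (g * f)}
      mul_mem' := fun {a c} ha hc f hf => by rw [mul_assoc]; exact ha _ (hc _ hf)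
      one_mem' := fun f hf => by rwa [one_mul]
      add_mem' := fun {a c} ha hc f hf => by rw [add_mul]; exact hadd _ _ (ha _ hf) (hc _ hf)
      zero_mem' := fun f _ => by rw [zero_mul]; exact h0
      neg_mem' := fun {a} ha f hf => by rw [neg_mul]; exact hneg _ (ha _ hf) }
  have hS : ∀ n : ℕ, h n ∈ S := fun n f hf => hmul n f hf
  have hE : ∀ n : ℕ, PowerSeries.coeff n E ∈ S := by
    intro n
    induction n using Nat.strong_induction_on with
    | _ n ih =>
      rcases n with _ | n
      · rw [PowerSeries.coeff_zero_eq_constantCoeff_apply, constantCoeff_E]; exact S.one_mem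
      · have hs := congrArg (PowerSeries.coeff (n + 1)) E_mul_H
        rw [PowerSeries.coeff_mul, Finset.Nat.sum_antidiagonal_succ', PowerSeries.coeff_one,
          if_neg (Nat.succ_ne_zero n)] at hs
        have hH0 : PowerSeries.coeff 0 H = 1 := by
          rw [← zcoeff_natCast, ← h_eq_zcoeff]; exact h_zero
        rw [hH0, mul_one] at hs
        rw [eq_neg_of_add_eq_zero_left hs]
        refine S.neg_mem (S.sum_mem fun p hp => ?_)
        rw [Finset.HasAntidiagonal.mem_antidiagonal] at hp
        refine S.mul_mem (ih _ (by lia)) ?_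
        rw [← zcoeff_natCast, ← h_eq_zcoeff]
        exact hS _
  have hX : ∀ k : ℕ, (MvPolynomial.X k : B) ∈ S := by
    intro k
    have := hE (k + 1)
    rw [E, PowerSeries.coeff_mk, if_neg (Nat.succ_ne_zero k), Nat.add_sub_cancel] at this
    have h2 := S.mul_mem (S.pow_mem (S.neg_mem S.one_mem) (k + 1)) this
    rw [← mul_assoc, ← mul_pow] at h2
    simpa using h2
  have htop : f ∈ S := by
    induction f using MvPolynomial.induction_on with
    | C a =>
      rw [show (MvPolynomial.C a : B) = ((a : ℤ) : B) by simp]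
      exact intCast_mem S a
    | add p q hp hq => exact S.add_mem hp hq
    | mul_X p k hp => exact S.mul_mem hp (hX k)
  simpa using htop 1 h1

/-! ### The Schubert derivations on `B` -/

/-- `σ₋ : B → B[t]`, `t = w⁻¹`, determined by `E(z) ↦ E(z) (1 - t z)`. -/
def sMinus : B →+* Polynomial B :=
  homOfSeries (PowerSeries.map C E * (1 - PowerSeries.C X * PowerSeries.X))

/-- `σ̄₋ : B → B[t]`, `t = z⁻¹`, determined by `H(w) ↦ H(w) (1 - t w)`. -/
def sBar : B →+* Polynomial B :=
  homOfSeries (PowerSeries.map C E * PowerSeries.mk fun n => X ^ n)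

theorem map_sMinus_E : PowerSeries.map sMinus E =
    PowerSeries.map C E * (1 - PowerSeries.C X * PowerSeries.X) := by
  apply map_homOfSeries
  simp [constantCoeff_map_E]

theorem geom_mul_one_sub : (PowerSeries.mk fun n => (X : Polynomial B) ^ n) *
    (1 - PowerSeries.C X * PowerSeries.X) = 1 := by
  ext1 n
  rw [mul_sub, mul_one, map_sub, mul_left_comm, PowerSeries.coeff_C_mul, PowerSeries.coeff_one]
  rcases n with _ | n
  · simp
  · rw [PowerSeries.coeff_succ_mul_X, PowerSeries.coeff_mk, PowerSeries.coeff_mk]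
    simp [pow_succ']

theorem map_sBar_E : PowerSeries.map sBar E =
    PowerSeries.map C E * PowerSeries.mk fun n => X ^ n := by
  apply map_homOfSeries
  simp [constantCoeff_map_E]

theorem map_sBar_H : PowerSeries.map sBar H =
    PowerSeries.map C H * (1 - PowerSeries.C X * PowerSeries.X) := by
  have h1 : PowerSeries.map sBar E * PowerSeries.map sBar H = 1 := by
    rw [← map_mul, E_mul_H, map_one]
  have h2 : PowerSeries.map (C (R := B)) E * PowerSeries.map C H = 1 := by
    rw [← map_mul, E_mul_H, map_one]
  have h3 := geom_mul_one_sub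
  rw [map_sBar_E] at h1
  linear_combination
    (PowerSeries.map C H * (1 - PowerSeries.C X * PowerSeries.X)) * h1
      - PowerSeries.map sBar H * h2 - PowerSeries.map sBar H *
      (PowerSeries.map (C (R := B)) E * PowerSeries.map C H) * h3

theorem map_sMinus_H : PowerSeries.map sMinus H * (1 - PowerSeries.C X * PowerSeries.X) =
    PowerSeries.map C H := by
  have h1 : PowerSeries.map sMinus E * PowerSeries.map sMinus H = 1 := by
    rw [← map_mul, E_mul_H, map_one]
  have h2 : PowerSeries.map (C (R := B)) E * PowerSeries.map C H = 1 := by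
    rw [← map_mul, E_mul_H, map_one]
  rw [map_sMinus_E] at h1
  linear_combination PowerSeries.map C H * h1 -
    PowerSeries.map sMinus H * (1 - PowerSeries.C X * PowerSeries.X) * h2

theorem sBar_h (n : ℤ) : sBar (h n) = C (h n) - X * C (h (n - 1)) := by
  rw [h_eq_zcoeff, ← zcoeff_map, map_sBar_H, zcoeff_mul_one_sub, zcoeff_map, zcoeff_map]
  rfl

/-- Division by `1 - t z`: iterating `u_n = v_n + t u_{n-1}` stops because `u` vanishes in negative
degrees. Any bound `K > n` is allowed, so that sums for different `n` can share one range. -/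
theorem eq_sum_of_recursion {R : Type} [CommRing R] (t : R) (u v : ℤ → R)
    (hu : ∀ n < 0, u n = 0) (huv : ∀ n, u n - t * u (n - 1) = v n) (n : ℤ) (K : ℕ)
    (hK : n < K) : u n = ∑ i ∈ Finset.range K, t ^ i * v (n - i) := by
  induction K generalizing n with
  | zero => rw [hu n (by simpa using hK)]; simp
  | succ K ih =>
    rw [Finset.sum_range_succ', eq_add_of_sub_eq (huv n), ih (n - 1) (by push_cast at hK; lia),
      Finset.mul_sum, add_comm]
    congr 1
    · refine Finset.sum_congr rfl fun i _ => ?_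
      rw [pow_succ', mul_assoc, show n - 1 - (i : ℤ) = n - ((i + 1 : ℕ) : ℤ) by push_cast; ring]
    · simp

theorem sMinus_h (n : ℤ) (K : ℕ) (hK : n < K) :
    sMinus (h n) = ∑ i ∈ Finset.range K, X ^ i * C (h (n - i)) := by
  refine eq_sum_of_recursion X (fun n => sMinus (h n)) (fun n => C (h n))
    (fun n hn => by rw [h_of_neg hn, map_zero]) (fun n => ?_) n K hK
  rw [h_eq_zcoeff, h_eq_zcoeff, ← zcoeff_map, ← zcoeff_map, ← zcoeff_mul_one_sub,
    map_sMinus_H, zcoeff_map]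

theorem sBar_e (n : ℤ) (K : ℕ) (hK : n < K) :
    sBar (e n) = ∑ i ∈ Finset.range K, X ^ i * C (e (n - i)) := by
  refine eq_sum_of_recursion X (fun n => sBar (e n)) (fun n => C (e n))
    (fun n hn => by rw [e_of_neg hn, map_zero]) (fun n => ?_) n K hK
  simp only [e]
  rw [← zcoeff_map, ← zcoeff_map, ← zcoeff_mul_one_sub,
    map_sBar_E, mul_assoc, geom_mul_one_sub, mul_one, zcoeff_map]

/-- Both iterated maps are ring homomorphisms into polynomials in two variables once `ρ` is applied
to the coefficients of `τ` and vice versa. Equality up to exchanging the variables therefore need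
only be tested on the `h_n`. -/
theorem coeff_comm_of_swap {ρ τ : B →+* Polynomial B}
    (H1 : ∀ n : ℤ, Polynomial.Bivariate.swap (Polynomial.mapRingHom ρ (τ (h n))) =
      Polynomial.mapRingHom τ (ρ (h n))) (f : B) (p q : ℕ) :
    (ρ ((τ f).coeff q)).coeff p = (τ ((ρ f).coeff p)).coeff q := by
  have hs : ((Polynomial.Bivariate.swap (R := B) : _ →+* _).comp
      ((Polynomial.mapRingHom ρ).comp τ)) = (Polynomial.mapRingHom τ).comp ρ :=
    hom_ext_h (R := Polynomial (Polynomial B)) fun n => H1 n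
  have hc : ∀ g : Polynomial (Polynomial B),
      ((Polynomial.Bivariate.swap g).coeff p).coeff q = (g.coeff q).coeff p := by
    intro g
    induction g using Polynomial.induction_on' with
    | add f g hf hg => simp only [map_add, Polynomial.coeff_add, hf, hg]
    | monomial n g =>
      induction g using Polynomial.induction_on' with
      | add f g hf hg => simp only [map_add, Polynomial.coeff_add, hf, hg]
      | monomial m c =>
        rw [Polynomial.Bivariate.swap_monomial_monomial]
        simp only [Polynomial.coeff_monomial]
        split_ifs <;> simp [Polynomial.coeff_monomial, *]
  have := congrArg (fun g => (g.coeff p).coeff q) (RingHom.congr_fun hs f)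
  simp only [RingHom.comp_apply, RingHom.coe_coe, hc] at this
  simpa using this

theorem sBar_sBar_comm (f : B) (p q : ℕ) :
    (sBar ((sBar f).coeff q)).coeff p = (sBar ((sBar f).coeff p)).coeff q := by
  refine coeff_comm_of_swap (fun n => ?_) f p q
  simp only [sBar_h, map_sub, map_mul, Polynomial.coe_mapRingHom, Polynomial.map_C,
    Polynomial.map_X, Polynomial.Bivariate.swap_C_C, Polynomial.Bivariate.swap_X,
    Polynomial.Bivariate.swap_Y]
  ring

theorem sMinus_sBar_comm (f : B) (p q : ℕ) :
    (sMinus ((sBar f).coeff q)).coeff p = (sBar ((sMinus f).coeff p)).coeff q := by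
  refine coeff_comm_of_swap (fun n => ?_) f p q
  have hK : n < n.toNat + 1 := by lia
  rw [sBar_h]
  simp only [map_sub, map_mul, Polynomial.coe_mapRingHom, Polynomial.map_C,
    Polynomial.map_X]
  rw [sMinus_h n _ hK, sMinus_h (n - 1) (n.toNat + 1) (by lia)]
  simp only [map_sub, map_mul, map_sum, map_pow, Polynomial.map_C,
    Polynomial.map_X, Polynomial.map_sum, Polynomial.map_mul, Polynomial.map_pow,
    Polynomial.Bivariate.swap_C_C, Polynomial.Bivariate.swap_X,
    Polynomial.Bivariate.swap_Y, sBar_h]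
  rw [Finset.mul_sum]
  have hsub : ∀ u v : ℕ → Polynomial (Polynomial B), ∑ i ∈ Finset.range (n.toNat + 1), u i -
      ∑ i ∈ Finset.range (n.toNat + 1), v i = ∑ i ∈ Finset.range (n.toNat + 1), (u i - v i) :=
    fun u v => (Finset.sum_sub_distrib u v).symm
  refine (hsub _ _).trans (Finset.sum_congr rfl fun i _ => ?_)
  rw [show n - 1 - (i : ℤ) = n - i - 1 by ring]
  ring

/-- `σ₋(t) σ̄₋(t) = 1`. -/
theorem sum_sMinus_sBar (f : B) (n : ℕ) :
    ∑ p ∈ Finset.HasAntidiagonal.antidiagonal n, (sMinus ((sBar f).coeff p.2)).coeff p.1 =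
      if n = 0 then f else 0 := by
  -- Setting both variables equal gives a ring homomorphism, which on each `h_n` telescopes to the
  -- constant `h_n`.
  have key : (Polynomial.eval₂RingHom sMinus X).comp sBar = C := by
    refine hom_ext_h fun n => ?_
    have h1 := sMinus_h n (n.toNat + 1) (by lia)
    rw [Finset.sum_range_succ'] at h1
    rw [RingHom.comp_apply, sBar_h, map_sub, map_mul]
    simp only [Polynomial.coe_eval₂RingHom, Polynomial.eval₂_C, Polynomial.eval₂_X]
    rw [h1, sMinus_h (n - 1) n.toNat (by lia), Finset.mul_sum]
    have h2 : ∀ i : ℕ, X * (X ^ i * C (h (n - 1 - i))) =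
        X ^ (i + 1) * C (h (n - ((i + 1 : ℕ) : ℤ))) := by
      intro i
      rw [show n - 1 - (i : ℤ) = n - ((i + 1 : ℕ) : ℤ) by push_cast; ring]; ring
    simp only [h2]
    simp
  have h1 := congrArg (Polynomial.coeff · n) (RingHom.congr_fun key f)
  simp only [RingHom.comp_apply, Polynomial.coe_eval₂RingHom, Polynomial.coeff_C] at h1
  rw [← h1, Polynomial.eval₂_eq_sum, Polynomial.sum_def, Polynomial.finsetSum_coeff]
  simp only [Polynomial.coeff_mul_X_pow']
  rw [Finset.Nat.sum_antidiagonal_eq_sum_range_succ_mk, ← Finset.sum_flip]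
  rw [← Finset.sum_filter]
  symm
  refine Finset.sum_subset_zero_on_sdiff ?_ ?_ ?_
  · intro q hq
    simp only [Finset.mem_filter, Finset.mem_range] at hq ⊢
    lia
  · intro q hq
    simp only [Finset.mem_sdiff, Finset.mem_filter, Finset.mem_range, not_and,
      Polynomial.mem_support_iff] at hq
    have : (sBar f).coeff q = 0 := by
      by_contra hne
      exact hq.2 hne (by lia)
    rw [show n - (n - q) = q by lia, this]; simp
  · intro q hq
    simp only [Finset.mem_filter] at hq
    rw [show n - (n - q) = q by lia]

/-! ### Vertex operators on `B` -/

/-- The `B`-linear map `B[t] → B` with `t^p ↦ s_{n+p}`, that is, the coefficient of `z^n` in the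
product of `∑ s_k z^k` with a polynomial in `t = z⁻¹`. -/
def pairing (s : ℤ → B) (n : ℤ) : Polynomial B →ₗ[B] B :=
  Polynomial.lsum fun p => s (n + p) • LinearMap.id

theorem pairing_eq_sum (s : ℤ → B) (n : ℤ) (g : Polynomial B) (N : ℕ) (hN : g.natDegree < N) :
    pairing s n g = ∑ p ∈ Finset.range N, s (n + p) * g.coeff p := by
  rw [pairing, Polynomial.lsum_apply]
  exact Polynomial.sum_over_range' _ (fun _ => by simp) N hN

theorem pairing_monomial (s : ℤ → B) (n : ℤ) (p : ℕ) (c : B) :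
    pairing s n (Polynomial.monomial p c) = s (n + p) * c := by
  rw [pairing, Polynomial.lsum_apply, Polynomial.sum_monomial_index] <;> simp

theorem pairing_X_mul (s : ℤ → B) (n : ℤ) (g : Polynomial B) :
    pairing s n (X * g) = pairing s (n + 1) g := by
  induction g using Polynomial.induction_on' with
  | add f g hf hg => rw [mul_add, map_add, map_add, hf, hg]
  | monomial p c =>
    rw [Polynomial.X_mul_monomial, pairing_monomial, pairing_monomial]
    congr 2; push_cast; ring

theorem pairing_X_pow_mul (s : ℤ → B) (n : ℤ) (i : ℕ) (g : Polynomial B) :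
    pairing s n (X ^ i * g) = pairing s (n + i) g := by
  induction i generalizing n with
  | zero => simp
  | succ i ih =>
    rw [pow_succ', mul_assoc, pairing_X_mul, ih,
      show n + 1 + (i : ℤ) = n + (i + 1 : ℕ) by push_cast; ring]

theorem pairing_C_mul (s : ℤ → B) (n : ℤ) (c : B) (g : Polynomial B) :
    pairing s n (C c * g) = c * pairing s n g := by
  rw [← Polynomial.smul_eq_C_mul, map_smul, smul_eq_mul]

theorem pairing_one (s : ℤ → B) (n : ℤ) : pairing s n 1 = s n := by
  have := pairing_monomial s n 0 1
  simpa using this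

/-- The coefficient of `z^n` in `E(z)⁻¹ σ̄₋(z)`. -/
def creation (n : ℤ) : B →+ B := (pairing h n).toAddMonoidHom.comp sBar.toAddMonoidHom

/-- The coefficient of `w^n` in `E(w) σ₋(w)`. -/
def annihilation (n : ℤ) : B →+ B := (pairing e n).toAddMonoidHom.comp sMinus.toAddMonoidHom

theorem creation_apply (n : ℤ) (f : B) : creation n f = pairing h n (sBar f) := rfl

theorem annihilation_apply (n : ℤ) (f : B) : annihilation n f = pairing e n (sMinus f) := rfl

theorem creation_one (n : ℤ) : creation n 1 = h n := by
  rw [creation_apply, map_one, pairing_one]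

theorem annihilation_one (n : ℤ) : annihilation n 1 = e n := by
  rw [annihilation_apply, map_one, pairing_one]

/-- Here `sBar (h k)` has only two terms, and multiplication by `t = z⁻¹` raises the extracted index
by one. -/
theorem creation_h_mul (n k : ℤ) (f : B) :
    creation n (h k * f) = h k * creation n f - h (k - 1) * creation (n + 1) f := by
  rw [creation_apply, map_mul, sBar_h, sub_mul, map_sub, pairing_C_mul, mul_assoc, pairing_X_mul,
    pairing_C_mul]
  rfl

/-- Moving `σ̄₋(z)` past `E(w)` multiplies by `1/(1 - w/z)`. This is the source of the factor
`i_{z,w} z/(z-w)` in the vertex formula. -/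
theorem creation_e_mul (n k : ℤ) (f : B) (K : ℕ) (hK : k < K) :
    creation n (e k * f) = ∑ i ∈ Finset.range K, e (k - i) * creation (n + i) f := by
  rw [creation_apply, map_mul, sBar_e k K hK, Finset.sum_mul, map_sum]
  refine Finset.sum_congr rfl fun i _ => ?_
  rw [mul_assoc, pairing_X_pow_mul, pairing_C_mul]
  rfl

theorem annihilation_h_mul (n k : ℤ) (f : B) (K : ℕ) (hK : k < K) :
    annihilation n (h k * f) = ∑ i ∈ Finset.range K, h (k - i) * annihilation (n + i) f := by
  rw [annihilation_apply, map_mul, sMinus_h k K hK, Finset.sum_mul, map_sum]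
  refine Finset.sum_congr rfl fun i _ => ?_
  rw [mul_assoc, pairing_X_pow_mul, pairing_C_mul]
  rfl

/-- A common truncation length for both variables lets the double sums below run over a fixed
square, so that their order can be exchanged. -/
theorem exists_natDegree_bound (ρ τ : B →+* Polynomial B) (f : B) :
    ∃ N : ℕ, ∀ K ≥ N, (τ f).natDegree < K ∧ ∀ q, (ρ ((τ f).coeff q)).natDegree < K := by
  refine ⟨(τ f).natDegree + 1 +
    ∑ q ∈ Finset.range ((τ f).natDegree + 1), (ρ ((τ f).coeff q)).natDegree, fun K hK =>
      ⟨by lia, fun q => ?_⟩⟩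
  rcases lt_or_ge (τ f).natDegree q with hq | hq
  · rw [Polynomial.coeff_eq_zero_of_natDegree_lt hq, map_zero, Polynomial.natDegree_zero]
    lia
  · have := Finset.single_le_sum (f := fun q => (ρ ((τ f).coeff q)).natDegree)
      (fun _ _ => Nat.zero_le _) (Finset.mem_range.2 (Nat.lt_succ_of_le hq))
    lia

/-! ### Clifford relations and commutation of the lowering derivations with creation operators. -/

theorem creation_eq_sum (n : ℤ) (f : B) (N : ℕ) (hN : (sBar f).natDegree < N) :
    creation n f = ∑ p ∈ Finset.range N, h (n + p) * (sBar f).coeff p :=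
  pairing_eq_sum h n _ N hN

theorem annihilation_eq_sum (n : ℤ) (f : B) (N : ℕ) (hN : (sMinus f).natDegree < N) :
    annihilation n f = ∑ p ∈ Finset.range N, e (n + p) * (sMinus f).coeff p :=
  pairing_eq_sum e n _ N hN

/-- The kernel `h_{l+q} h_{k-1+p} - h_{l-1+q} h_{k+p}` changes sign under exchanging `(k, p)` with
`(l, q)`, while the iterated coefficients of `sBar` are symmetric in `p` and `q`. The shifts by one
account for the change of charge between the two operators. -/
theorem creation_creation (k l : ℤ) (f : B) :
    creation (k - 1) (creation l f) = -creation (l - 1) (creation k f) := by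
  obtain ⟨N, hN⟩ := exists_natDegree_bound sBar sBar f
  obtain ⟨h1, h2⟩ := hN N le_rfl
  have key : ∀ k l : ℤ, creation (k - 1) (creation l f) = ∑ q ∈ Finset.range N,
      ∑ p ∈ Finset.range N, (h (l + q) * h (k - 1 + p) - h (l - 1 + q) * h (k + p)) *
        (sBar ((sBar f).coeff q)).coeff p := by
    intro k l
    rw [creation_eq_sum l f N h1, map_sum]
    refine Finset.sum_congr rfl fun q _ => ?_
    rw [creation_h_mul, creation_eq_sum _ _ N (h2 q), creation_eq_sum _ _ N (h2 q),
      Finset.mul_sum, Finset.mul_sum, ← Finset.sum_sub_distrib]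
    refine Finset.sum_congr rfl fun p _ => ?_
    rw [sub_add_cancel, show l + (q : ℤ) - 1 = l - 1 + q by ring]
    ring
  rw [key, key, Finset.sum_comm, ← Finset.sum_neg_distrib]
  refine Finset.sum_congr rfl fun q _ => ?_
  rw [← Finset.sum_neg_distrib]
  refine Finset.sum_congr rfl fun p _ => ?_
  rw [sBar_sBar_comm f q p]
  ring

/-- The Clifford relation between the coefficients of `E(w) σ₋(w)` and of `E(z)⁻¹ σ̄₋(z)`. -/
theorem annihilation_creation (k l : ℤ) (f : B) :
    annihilation k (creation l f) + creation (l + 1) (annihilation (k - 1) f) =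
      if k + l = 0 then f else 0 := by
  obtain ⟨N₁, hN₁⟩ := exists_natDegree_bound sMinus sBar f
  obtain ⟨N₂, hN₂⟩ := exists_natDegree_bound sBar sMinus f
  -- The bound `-(k + l) < N` places the whole antidiagonal `p + q = -(k + l)` inside the square of
  -- side `N`.
  obtain ⟨N, hNN₁, hNN₂, hNk⟩ :
      ∃ N : ℕ, N₁ ≤ N ∧ N₂ ≤ N ∧ -(k + l) < N := ⟨N₁ + N₂ + (-(k + l)).toNat + 1, by lia⟩
  obtain ⟨h1, h2⟩ := hN₁ N hNN₁
  obtain ⟨h3, h4⟩ := hN₂ N hNN₂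
  obtain ⟨K, hkK, hlK⟩ : ∃ K : ℕ, k + N < K ∧ l + N < K :=
    ⟨(k + N).toNat + (l + N).toNat + 1, by lia⟩
  have key1 : annihilation k (creation l f) = ∑ q ∈ Finset.range N, ∑ p ∈ Finset.range N,
      (∑ i ∈ Finset.range (K + 1), e (k + p + i) * h (l + q - i)) *
        (sMinus ((sBar f).coeff q)).coeff p := by
    rw [creation_eq_sum l f N h1, map_sum]
    refine Finset.sum_congr rfl fun q hq => ?_
    rw [Finset.mem_range] at hq
    rw [annihilation_h_mul _ _ _ (K + 1) (by push_cast; lia)]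
    simp only [Finset.sum_mul]
    rw [Finset.sum_comm]
    refine Finset.sum_congr rfl fun i _ => ?_
    rw [annihilation_eq_sum _ _ N (h2 q), Finset.mul_sum]
    refine Finset.sum_congr rfl fun p _ => ?_
    rw [show k + (i : ℤ) + p = k + p + i by ring]
    ring
  have key2 : creation (l + 1) (annihilation (k - 1) f) = ∑ q ∈ Finset.range N,
      ∑ p ∈ Finset.range N, (∑ i ∈ Finset.range K, e (k + p - 1 - i) * h (l + q + 1 + i)) *
        (sMinus ((sBar f).coeff q)).coeff p := by
    rw [annihilation_eq_sum _ f N h3, map_sum, Finset.sum_comm]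
    refine Finset.sum_congr rfl fun p hp => ?_
    rw [Finset.mem_range] at hp
    rw [creation_e_mul _ _ _ K (by lia)]
    simp only [Finset.sum_mul]
    rw [Finset.sum_comm]
    refine Finset.sum_congr rfl fun i _ => ?_
    rw [creation_eq_sum _ _ N (h4 p), Finset.mul_sum]
    refine Finset.sum_congr rfl fun q _ => ?_
    rw [show k - 1 + (p : ℤ) - i = k + p - 1 - i by ring,
      show l + 1 + (i : ℤ) + q = l + q + 1 + i by ring, sMinus_sBar_comm]
    ring
  -- The two sums are the halves `i ≥ 0` and `i < 0` (through `i ↦ -1 - i`) of one coefficient of `E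
  -- H = 1`.
  have key3 : ∀ p ∈ Finset.range N, ∀ q ∈ Finset.range N,
      (∑ i ∈ Finset.range (K + 1), e (k + p + i) * h (l + q - i)) +
      (∑ i ∈ Finset.range K, e (k + p - 1 - i) * h (l + q + 1 + i)) =
      if k + p + (l + q) = 0 then 1 else 0 := by
    intro p hp q hq
    rw [Finset.mem_range] at hp hq
    rw [← sum_e_mul_h (k + p) (l + q) K (by lia) (by lia),
      ← Finset.Ico_union_Ico_eq_Ico (show -(K : ℤ) ≤ 0 by lia) (show (0 : ℤ) ≤ K + 1 by lia),
      Finset.sum_union (Finset.Ico_disjoint_Ico_consecutive _ _ _), add_comm]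
    congr 1
    · refine Finset.sum_bij (fun i _ => -1 - (i : ℤ)) ?_ ?_ ?_ ?_
      · intro i hi
        rw [Finset.mem_range] at hi
        rw [Finset.mem_Ico]; lia
      · intro i _ j _ hij; lia
      · intro j hj
        rw [Finset.mem_Ico] at hj
        exact ⟨(-1 - j).toNat, by rw [Finset.mem_range]; lia, by lia⟩
      · intro i _
        rw [show k + (p : ℤ) - 1 - i = k + p + (-1 - i) by ring,
          show l + (q : ℤ) + 1 + i = l + q - (-1 - i) by ring]
    · refine Finset.sum_bij (fun i _ => (i : ℤ)) ?_ ?_ ?_ ?_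
      · intro i hi
        rw [Finset.mem_range] at hi
        rw [Finset.mem_Ico]; lia
      · intro i _ j _ hij; lia
      · intro j hj
        rw [Finset.mem_Ico] at hj
        exact ⟨j.toNat, by rw [Finset.mem_range]; lia, by lia⟩
      · intro i _; rfl
  have key4 : annihilation k (creation l f) + creation (l + 1) (annihilation (k - 1) f) =
      ∑ q ∈ Finset.range N, ∑ p ∈ Finset.range N,
        if k + p + (l + q) = 0 then (sMinus ((sBar f).coeff q)).coeff p else 0 := by
    rw [key1, key2, ← Finset.sum_add_distrib]
    refine Finset.sum_congr rfl fun q hq => ?_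
    rw [← Finset.sum_add_distrib]
    refine Finset.sum_congr rfl fun p hp => ?_
    rw [← add_mul, key3 p hp q hq, ite_mul, one_mul, zero_mul]
  rw [key4]
  -- Only pairs with `p + q = -(k + l)` survive: there are none if `k + l > 0`, and otherwise they
  -- sum to a coefficient of `σ₋(t) σ̄₋(t) f = f`.
  rcases lt_or_ge 0 (k + l) with hkl | hkl
  · rw [if_neg hkl.ne']
    exact Finset.sum_eq_zero fun q _ => Finset.sum_eq_zero fun p _ => if_neg (by lia)
  · obtain ⟨n, hn⟩ := Int.eq_ofNat_of_zero_le (neg_nonneg.2 hkl)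
    rw [if_congr (show k + l = 0 ↔ n = 0 by lia) rfl rfl, ← sum_sMinus_sBar f n,
      Finset.sum_comm, ← Finset.sum_product', ← Finset.sum_filter]
    refine Finset.sum_congr ?_ fun _ _ => rfl
    ext ⟨p, q⟩
    simp only [Finset.mem_filter, Finset.mem_product, Finset.mem_range,
      Finset.HasAntidiagonal.mem_antidiagonal]
    lia

/-- The bosonic counterpart of `σ̄₋(z) b_k = b_k - b_{k-1} z⁻¹`: lowering `k` by one lowers the
index of `creation` by one. -/
theorem coeff_sBar_creation (n : ℤ) (p : ℕ) (f : B) :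
    (sBar (creation n f)).coeff (p + 1) =
      creation n ((sBar f).coeff (p + 1)) - creation (n - 1) ((sBar f).coeff p) := by
  obtain ⟨N, hN⟩ := exists_natDegree_bound sBar sBar f
  obtain ⟨h1, h2⟩ := hN N le_rfl
  rw [creation_eq_sum n f N h1, map_sum, Polynomial.finsetSum_coeff,
    creation_eq_sum _ _ N (h2 _), creation_eq_sum _ _ N (h2 _), ← Finset.sum_sub_distrib]
  refine Finset.sum_congr rfl fun q _ => ?_
  rw [map_mul, sBar_h, sub_mul, Polynomial.coeff_sub, Polynomial.coeff_C_mul, mul_assoc,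
    Polynomial.coeff_X_mul, Polynomial.coeff_C_mul, sBar_sBar_comm f (p + 1), sBar_sBar_comm f p,
    show n + (q : ℤ) - 1 = n - 1 + q by ring]

theorem coeff_sBar_creation_zero (n : ℤ) (f : B) :
    (sBar (creation n f)).coeff 0 = creation n ((sBar f).coeff 0) := by
  obtain ⟨N, hN⟩ := exists_natDegree_bound sBar sBar f
  obtain ⟨h1, h2⟩ := hN N le_rfl
  rw [creation_eq_sum n f N h1, map_sum, Polynomial.finsetSum_coeff,
    creation_eq_sum _ _ N (h2 _)]
  refine Finset.sum_congr rfl fun q _ => ?_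
  rw [map_mul, sBar_h, sub_mul, Polynomial.coeff_sub, Polynomial.coeff_C_mul, mul_assoc,
    Polynomial.coeff_X_mul_zero, sub_zero, sBar_sBar_comm f 0]

/-- The bosonic counterpart of `σ₋(z) b_k = ∑ b_{k-i} z⁻ⁱ`, obtained from `sMinus_h` and the
commutation of `sMinus` with `sBar`. -/
theorem coeff_sMinus_creation (n : ℤ) (p : ℕ) (f : B) :
    (sMinus (creation n f)).coeff p = ∑ x ∈ Finset.HasAntidiagonal.antidiagonal p,
      creation (n - x.1) ((sMinus f).coeff x.2) := by
  obtain ⟨N₁, hN₁⟩ := exists_natDegree_bound sMinus sBar f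
  obtain ⟨N₂, hN₂⟩ := exists_natDegree_bound sBar sMinus f
  obtain ⟨h1, h2⟩ := hN₁ (N₁ + N₂) (by lia)
  obtain ⟨h3, h4⟩ := hN₂ (N₁ + N₂) (by lia)
  rw [creation_eq_sum n f _ h1, map_sum, Polynomial.finsetSum_coeff]
  simp only [creation_eq_sum _ _ _ (h4 _)]
  rw [Finset.sum_comm]
  refine Finset.sum_congr rfl fun q _ => ?_
  rw [map_mul, sMinus_h _ ((n + q).toNat + p + 1) (by push_cast; lia), Polynomial.coeff_mul]
  refine Finset.sum_congr rfl fun x hx => ?_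
  rw [Finset.HasAntidiagonal.mem_antidiagonal] at hx
  rw [← sMinus_sBar_comm, Polynomial.finsetSum_coeff, Finset.sum_eq_single x.1]
  · rw [Polynomial.coeff_X_pow_mul', if_pos le_rfl, Nat.sub_self, Polynomial.coeff_C_zero,
      show n + (q : ℤ) - x.1 = n - x.1 + q by ring]
  · intro i _ hi
    rw [mul_comm, Polynomial.coeff_C_mul_X_pow, if_neg hi.symm]
  · intro hx'
    rw [Finset.mem_range] at hx'
    lia

/-! ### The bosonic model of the Fock space -/

theorem ext_smul_mem (S : AddSubgroup F) (hb : ∀ k, ∀ φ ∈ S, b k • φ ∈ S) (u : ExtM) :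
    ∀ φ ∈ S, u • φ ∈ S := by
  induction u using ExteriorAlgebra.induction with
  | algebraMap r =>
    intro φ hφ
    rw [Algebra.algebraMap_eq_smul_one, smul_assoc, one_smul]
    exact S.zsmul_mem hφ r
  | ι v =>
    intro φ hφ
    induction v using Finsupp.induction_linear with
    | zero => simp [S.zero_mem]
    | add x y hx hy => rw [map_add, add_smul]; exact S.add_mem hx hy
    | single k c =>
      have : ExteriorAlgebra.ι ℤ (Finsupp.single k c) • φ = c • (b k • φ) := by
        rw [← smul_assoc, b, ← map_zsmul, Finsupp.smul_single, smul_eq_mul, mul_one]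
      rw [this]
      exact S.zsmul_mem (hb k φ hφ) c
  | mul x y hx hy => intro φ hφ; rw [mul_smul]; exact hx _ (hy _ hφ)
  | add x y hx hy => intro φ hφ; rw [add_smul]; exact S.add_mem (hx _ hφ) (hy _ hφ)

/-- The Fock space is generated by the `[b]_m` with `m < c` under wedging with the `b_k`. -/
theorem F_mem_of_vac (S : AddSubgroup F) (c : ℤ) (hv : ∀ m < c, vac m ∈ S)
    (hb : ∀ k, ∀ φ ∈ S, b k • φ ∈ S) (φ : F) : φ ∈ S := by
  have hvac : ∀ m : ℤ, vac m ∈ S := by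
    intro m
    rcases lt_or_ge m c with h1 | h1
    · exact hv m h1
    · induction m, h1 using Int.leInduction with
      | base => rw [← b_smul_vac_pred]; exact hb _ _ (hv _ (by lia))
      | succ m _ ih =>
        rw [← b_smul_vac_pred, add_sub_cancel_right]; exact hb _ _ ih
  induction φ using F_induction with
  | h0 => exact S.zero_mem
  | hadd x y hx hy => exact S.add_mem hx hy
  | h u m => exact ext_smul_mem S hb u _ (hvac m)

/-- The cutoff `c` serves `δ(ℬ_ij)`, which visibly kills `[b]_m` only for `m < j`. -/
theorem addHom_ext_F {A : Type} [AddCommGroup A] (p q : F →+ A) (c : ℤ)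
    (hv : ∀ m < c, p (vac m) = q (vac m))
    (hb : ∀ k φ, p φ = q φ → p (b k • φ) = q (b k • φ)) (φ : F) : p φ = q φ :=
  F_mem_of_vac (p.eqLocus q) c hv (fun k φ hφ => hb k φ hφ) φ

/-- The bosonic Fock space: the direct sum of copies of `B`, one for each charge. -/
abbrev V : Type := ℤ →₀ B

/-- A family of additive maps `B → B`, one for each charge, assembled to a map of the bosonic Fock
space which raises the charge by `c`. -/
def chargeMap (c : ℤ) (g : ℤ → B →+ B) : V →+ V :=
  Finsupp.liftAddHom fun m => (Finsupp.singleAddHom (m + c)).comp (g m)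

theorem chargeMap_single (c : ℤ) (g : ℤ → B →+ B) (m : ℤ) (f : B) :
    chargeMap c g (Finsupp.single m f) = Finsupp.single (m + c) (g m f) := by
  simp [chargeMap]

/-- The action of `b_k` on the bosonic Fock space. -/
def raise (k : ℤ) : V →+ V := chargeMap 1 fun m => creation (k - m - 1)

theorem raise_single (k m : ℤ) (f : B) :
    raise k (Finsupp.single m f) = Finsupp.single (m + 1) (creation (k - m - 1) f) :=
  chargeMap_single _ _ _ _

theorem raise_raise (k l : ℤ) (v : V) : raise k (raise l v) = -raise l (raise k v) := by
  induction v using Finsupp.induction_linear with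
  | zero => simp
  | add x y hx hy => simp only [map_add, hx, hy, neg_add]
  | single m f =>
    rw [raise_single, raise_single, raise_single, raise_single, ← Finsupp.single_neg,
      show k - (m + 1) - 1 = (k - m - 1) - 1 by ring, creation_creation,
      show l - (m + 1) - 1 = (l - m - 1) - 1 by ring]

/-- The linear extension of `b_k ↦ raise k`. -/
def raiseLin : M →ₗ[ℤ] Module.End ℤ V :=
  Finsupp.linearCombination ℤ fun k => (raise k).toIntLinearMap

theorem raiseLin_single (k c : ℤ) (v : V) : raiseLin (Finsupp.single k c) v = c • raise k v := by
  simp [raiseLin]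

theorem raiseLin_anticomm (x y : M) : raiseLin x * raiseLin y + raiseLin y * raiseLin x = 0 := by
  induction x using Finsupp.induction_linear with
  | zero => simp
  | add x x' hx hx' =>
    rw [map_add, add_mul, mul_add, add_add_add_comm, hx, hx', add_zero]
  | single k c =>
    induction y using Finsupp.induction_linear with
    | zero => simp
    | add y y' hy hy' =>
      rw [map_add, add_mul, mul_add, add_add_add_comm, hy, hy', add_zero]
    | single l d =>
      refine LinearMap.ext fun v => ?_
      simp only [LinearMap.add_apply, Module.End.mul_apply, raiseLin_single, map_zsmul,
        LinearMap.zero_apply]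
      rw [smul_comm, ← smul_add, ← smul_add, raise_raise, neg_add_cancel, smul_zero, smul_zero]

/-- Anticommutation of an operator with itself gives only twice its square equal to zero; `B` has no
2-torsion. -/
theorem raiseLin_sq (x : M) : raiseLin x * raiseLin x = 0 := by
  refine LinearMap.ext fun v => Finsupp.ext fun w => ?_
  have := congrArg (fun T : Module.End ℤ V => T v w) (raiseLin_anticomm x x)
  exact add_self_eq_zero.1 this

/-- The representation of the exterior algebra on the bosonic Fock space. -/
def rep : ExtM →ₐ[ℤ] Module.End ℤ V := ExteriorAlgebra.lift ℤ ⟨raiseLin, raiseLin_sq⟩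

theorem rep_b (k : ℤ) (v : V) : rep (b k) v = raise k v := by
  rw [b, rep, ExteriorAlgebra.lift_ι_apply, raiseLin_single, one_smul]

/-- The map from the fermionic to the bosonic Fock space. -/
def toV : F →+ V :=
  liftF (fun m => (LinearMap.applyₗ (R := ℤ) (Finsupp.single m 1 : V)).toAddMonoidHom.comp
      rep.toRingHom.toAddMonoidHom)
    (by
      intro m x
      change rep (x * b m) (Finsupp.single (m - 1) 1) = rep x (Finsupp.single m 1)
      -- The two families of relations defining `W` become `h_0 = 1` here and `h_{-1} = 0` below.
      rw [map_mul, Module.End.mul_apply, rep_b, raise_single, creation_one, sub_add_cancel,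
        show m - (m - 1) - 1 = 0 by ring, h_zero])
    (by
      intro m x
      change rep (x * b m) (Finsupp.single m 1) = 0
      rw [map_mul, Module.End.mul_apply, rep_b, raise_single, creation_one,
        h_of_neg (by lia), Finsupp.single_zero, map_zero])

theorem toV_smul_vac (u : ExtM) (m : ℤ) : toV (u • vac m) = rep u (Finsupp.single m 1) :=
  liftF_smul_vac _ _ _ _ _

theorem toV_vac (m : ℤ) : toV (vac m) = Finsupp.single m 1 := by
  have := toV_smul_vac 1 m
  rwa [one_smul, map_one] at this

theorem toV_b_smul (k : ℤ) (φ : F) : toV (b k • φ) = raise k (toV φ) := by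
  induction φ using F_induction with
  | h0 => simp
  | hadd x y hx hy => rw [smul_add, map_add, hx, hy, map_add, map_add]
  | h u m => rw [smul_smul, toV_smul_vac, map_mul, toV_smul_vac, Module.End.mul_apply, rep_b]

/-- Multiplication by `h_n` against wedging with `b_k`. -/
theorem sum_raise_h_smul (k : ℤ) (n : ℕ) (v : V) :
    ∑ p ∈ Finset.HasAntidiagonal.antidiagonal n, raise (k + p.1) (h p.2 • v) =
      h n • raise k v := by
  induction v using Finsupp.induction_linear with
  | zero => simp
  | add x y hx hy => simp only [smul_add, map_add, Finset.sum_add_distrib, hx, hy]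
  | single m f =>
    simp only [Finsupp.smul_single, raise_single, smul_eq_mul]
    refine (map_sum (Finsupp.singleAddHom (m + 1)) _ _).symm.trans ?_
    rw [Finsupp.singleAddHom_apply]
    congr 1
    simp only [creation_h_mul]
    rw [Finset.Nat.sum_antidiagonal_eq_sum_range_succ_mk]
    -- The sum telescopes; at `N = n + 1` the remaining boundary term contains `h_{-1} = 0`.
    have key : ∀ N ≤ n + 1, ∑ i ∈ Finset.range N,
        (h ((n - i : ℕ) : ℤ) * creation (k + i - m - 1) f -
          h (((n - i : ℕ) : ℤ) - 1) * creation (k + i - m - 1 + 1) f) =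
        h n * creation (k - m - 1) f - h (n - N) * creation (k + N - m - 1) f := by
      intro N hN
      induction N with
      | zero => simp
      | succ N ih =>
        rw [Finset.sum_range_succ, ih (by lia), show ((n - N : ℕ) : ℤ) = n - N by lia,
          show (n : ℤ) - N - 1 = n - (N + 1 : ℕ) by push_cast; ring,
          show k + (N : ℤ) - m - 1 + 1 = k + (N + 1 : ℕ) - m - 1 by push_cast; ring]
        ring
    rw [key (n + 1) le_rfl, h_of_neg (n := (n : ℤ) - (n + 1 : ℕ)) (by push_cast; lia), zero_mul,
      sub_zero]

/-- The recursion of `σ_n` under wedging with `b_k` matches `sum_raise_h_smul`. It involves all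
`σ_p` with `p ≤ n`, so the subgroup used is the one where the claim holds for all `n` at once. -/
theorem toV_sigmaPlusF (n : ℕ) (φ : F) : toV (sigmaPlusF n φ) = h n • toV φ := by
  have key : φ ∈ (⨅ n : ℕ, (toV.comp (sigmaPlusF n).toAddMonoidHom).eqLocus
      ((DistribSMul.toAddMonoidHom V (h n)).comp toV) : AddSubgroup F) := by
    refine F_mem_of_vac _ 0 (fun m _ => ?_) (fun k φ hφ => ?_) φ
    · rw [AddSubgroup.mem_iInf]
      intro n
      change toV (sigmaPlusF n (vac m)) = h n • toV (vac m)
      rw [sigmaPlusF_vac, toV_b_smul, toV_vac, toV_vac, raise_single, creation_one,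
        sub_add_cancel, Finsupp.smul_single, smul_eq_mul, mul_one,
        show m + n - (m - 1) - 1 = (n : ℤ) by ring]
    · rw [AddSubgroup.mem_iInf] at hφ ⊢
      intro n
      have hφ' : ∀ n, toV (sigmaPlusF n φ) = h n • toV φ := hφ
      change toV (sigmaPlusF n (b k • φ)) = h n • toV (b k • φ)
      rw [sigmaPlusF_b_smul, map_sum, toV_b_smul, ← sum_raise_h_smul]
      exact Finset.sum_congr rfl fun p _ => by rw [toV_b_smul, hφ']
  exact AddSubgroup.mem_iInf.1 key n

/-! ### The map `f ↦ f [b]_m` and the injectivity of `toV`. -/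

theorem act_one : act 1 = 1 := by simp [act]

theorem act_add (f g : B) : act (f + g) = act f + act g := by simp [act]

theorem act_neg (f : B) : act (-f) = -act f := by simp [act]

theorem act_mul (f g : B) : act (f * g) = act f * act g := by simp [act]

theorem toV_act (f : B) (φ : F) : toV (act f φ) = f • toV φ := by
  induction f using B_induction with
  | h1 => rw [act_one, one_smul]; rfl
  | hadd f g hf hg => rw [act_add, add_smul, ← hf, ← hg, ← map_add]; rfl
  | hneg f hf => rw [act_neg, neg_smul, ← hf, ← map_neg]; rfl
  | hmul n f hf => rw [act_mul, Module.End.mul_apply, act_h, toV_sigmaPlusF, hf, mul_smul]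

theorem toV_bf (m : ℤ) (f : B) : toV (bf m f) = Finsupp.single m f := by
  rw [bf, toV_act, toV_vac, Finsupp.smul_single, smul_eq_mul, mul_one]

theorem bf_injective (m : ℤ) : Function.Injective (bf m) := fun f g hfg =>
  Finsupp.single_injective m (by rw [← toV_bf, ← toV_bf, hfg])

theorem bf_one (m : ℤ) : bf m 1 = vac m := by rw [bf, act_one]; rfl

theorem bf_add (m : ℤ) (f g : B) : bf m (f + g) = bf m f + bf m g := by rw [bf, act_add]; rfl

theorem bf_neg (m : ℤ) (f : B) : bf m (-f) = -bf m f := by rw [bf, act_neg]; rfl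

theorem bf_sub (m : ℤ) (f g : B) : bf m (f - g) = bf m f - bf m g := by
  rw [sub_eq_add_neg, bf_add, bf_neg, ← sub_eq_add_neg]

theorem bf_zero (m : ℤ) : bf m 0 = 0 := by simp [bf, act]

theorem bf_h_mul (m : ℤ) (n : ℕ) (f : B) : bf m (h n * f) = sigmaPlusF n (bf m f) := by
  rw [bf, act_mul, act_h]; rfl

/-- The map from the bosonic to the fermionic Fock space. -/
def ofV : V →+ F := Finsupp.liftAddHom fun m =>
  { toFun := bf m, map_zero' := bf_zero m, map_add' := bf_add m }

theorem ofV_single (m : ℤ) (f : B) : ofV (Finsupp.single m f) = bf m f := by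
  rw [ofV, Finsupp.liftAddHom_apply_single]; rfl

/-- Since `σ₊(z)(b_k - z b_{k+1}) = b_k`, wedging with `b_k` after `σ₊(z)` equals `σ₊(z)` after
wedging with `b_k - z b_{k+1}`. This mirrors `creation_h_mul`. -/
theorem b_smul_sigmaPlusF (k : ℤ) (n : ℕ) (φ : F) :
    b k • sigmaPlusF (n + 1) φ = sigmaPlusF (n + 1) (b k • φ) - sigmaPlusF n (b (k + 1) • φ) := by
  rw [sigmaPlusF_b_smul, sigmaPlusF_b_smul, Finset.Nat.sum_antidiagonal_succ, eq_sub_iff_add_eq]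
  congr 1
  · simp
  · refine Finset.sum_congr rfl fun p _ => ?_
    simp only
    rw [show k + 1 + (p.1 : ℤ) = k + ((p.1 + 1 : ℕ) : ℤ) by push_cast; ring]

/-- The bosonic expression for wedging with `b_k`. -/
theorem b_smul_bf (k m : ℤ) (f : B) : b k • bf m f = bf (m + 1) (creation (k - m - 1) f) := by
  -- The index `k` varies because multiplying `f` by `h_n` brings in `b_{k+1}`.
  induction f using B_induction generalizing k with
  | h1 =>
    rw [bf_one, creation_one]
    rcases lt_or_ge m k with hk | hk
    · obtain ⟨n, hn⟩ := Int.eq_ofNat_of_zero_le (show 0 ≤ k - m - 1 by lia)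
      rw [hn, bf, act_h, sigmaPlusF_vac, add_sub_cancel_right]
      congr 2; lia
    · rw [b_smul_vac_of_le hk, h_of_neg (by lia), bf_zero]
  | hadd f g hf hg => rw [bf_add, smul_add, hf, hg, map_add, bf_add]
  | hneg f hf => rw [bf_neg, smul_neg, hf, map_neg, bf_neg]
  | hmul n f hf =>
    rw [creation_h_mul, bf_sub, bf_h_mul, bf_h_mul, ← hf]
    rcases n with _ | n
    · rw [Nat.cast_zero, h_of_neg (n := 0 - 1) (by lia), zero_mul, bf_zero, sub_zero,
        sigmaPlusF_zero]; rfl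
    · rw [b_smul_sigmaPlusF, show ((n + 1 : ℕ) : ℤ) - 1 = n by push_cast; ring, bf_h_mul,
        show k - m - 1 + 1 = k + 1 - m - 1 by ring, ← hf]

theorem ofV_toV (φ : F) : ofV (toV φ) = φ := by
  refine addHom_ext_F (ofV.comp toV) (AddMonoidHom.id F) 0 (fun m _ => ?_) (fun k φ hφ => ?_) φ
  · change ofV (toV (vac m)) = vac m
    rw [toV_vac, ofV_single, bf_one]
  · have hφ' : ofV (toV φ) = φ := hφ
    change ofV (toV (b k • φ)) = b k • φ
    rw [toV_b_smul]
    conv_rhs => rw [← hφ']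
    induction toV φ using Finsupp.induction_linear with
    | zero => simp
    | add x y hx hy => rw [map_add, map_add, map_add, smul_add, hx, hy]
    | single m f => rw [raise_single, ofV_single, ofV_single, b_smul_bf]

theorem toV_injective : Function.Injective toV := Function.LeftInverse.injective ofV_toV

/-! ### The bosonic expressions of the lowering Schubert derivations and of `gl_∞` -/

theorem sigmaMinusF_b_smul (n : ℕ) (k : ℤ) (φ : F) :
    sigmaMinusF n (b k • φ) =
      ∑ p ∈ Finset.HasAntidiagonal.antidiagonal n, b (k - p.1) • sigmaMinusF p.2 φ := by
  induction φ using F_induction with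
  | h0 => simp
  | hadd x y hx hy => simp only [smul_add, map_add, hx, hy, Finset.sum_add_distrib]
  | h u m =>
    rw [smul_smul, sigmaMinusF_smul_vac, hsCoeff_mul, Finset.sum_smul]
    refine Finset.sum_congr rfl fun p _ => ?_
    rw [sigmaMinusF_smul_vac, smul_smul]
    congr 2
    rw [b, hsCoeff_ι, sigmaMinusD, shift_single]; rfl

theorem hsCoeff_one (D : ℕ → Module.End ℤ M) (n : ℕ) :
    hsCoeff D n 1 = if n = 0 then 1 else 0 := by
  rw [hsCoeff_apply, map_one, PowerSeries.coeff_one]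

theorem sigmaMinusF_vac (n : ℕ) (m : ℤ) : sigmaMinusF n (vac m) = if n = 0 then vac m else 0 := by
  have := sigmaMinusF_smul_vac n 1 m
  rw [one_smul, hsCoeff_one, ite_smul, one_smul, zero_smul] at this
  exact this

theorem sigmaBarMinusF_vac (n : ℕ) (m : ℤ) :
    sigmaBarMinusF n (vac m) = if n = 0 then vac m else 0 := by
  have := sigmaBarMinusF_smul_vac n 1 m
  rw [one_smul, hsCoeff_one, ite_smul, one_smul, zero_smul] at this
  exact this

theorem hsCoeff_sigmaBarMinusD_b (n : ℕ) (k : ℤ) :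
    hsCoeff sigmaBarMinusD n (b k) = if n = 0 then b k else if n = 1 then -b (k - 1) else 0 := by
  rw [b, hsCoeff_ι, sigmaBarMinusD]
  split_ifs with h1 h2
  · rfl
  · rw [LinearMap.neg_apply, shift_single, map_neg]; rfl
  · simp

theorem sigmaBarMinusF_zero_b_smul (k : ℤ) (φ : F) :
    sigmaBarMinusF 0 (b k • φ) = b k • sigmaBarMinusF 0 φ := by
  induction φ using F_induction with
  | h0 => simp
  | hadd x y hx hy => simp only [smul_add, map_add, hx, hy]
  | h u m =>
    rw [smul_smul, sigmaBarMinusF_smul_vac, hsCoeff_mul, sigmaBarMinusF_smul_vac, smul_smul]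
    simp [hsCoeff_sigmaBarMinusD_b]

theorem sigmaBarMinusF_succ_b_smul (n : ℕ) (k : ℤ) (φ : F) :
    sigmaBarMinusF (n + 1) (b k • φ) =
      b k • sigmaBarMinusF (n + 1) φ - b (k - 1) • sigmaBarMinusF n φ := by
  induction φ using F_induction with
  | h0 => simp
  | hadd x y hx hy => simp only [smul_add, map_add, hx, hy]; abel
  | h u m =>
    simp only [smul_smul, sigmaBarMinusF_smul_vac, hsCoeff_mul]
    rw [← sub_smul]
    congr 1
    rw [Finset.Nat.sum_antidiagonal_succ, Finset.sum_eq_single (0, n)]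
    · simp [hsCoeff_sigmaBarMinusD_b, sub_eq_add_neg]
    · rintro ⟨p, q⟩ hp hne
      rw [Finset.HasAntidiagonal.mem_antidiagonal] at hp
      have hp0 : p ≠ 0 := by
        rintro rfl
        exact hne (by simpa using hp)
      simp [hsCoeff_sigmaBarMinusD_b, hp0]
    · intro hn; simp at hn

theorem delta_one (A : Module.End ℤ M) : delta A 1 = 0 := by
  simpa using delta_mul A 1 1

theorem deltaF_vac (i : ℤ) {j n : ℤ} (hn : n < j) : deltaF i j (vac n) = 0 := by
  have := deltaF_smul_vac i hn 1
  rwa [one_smul, delta_one, zero_smul] at this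

theorem deltaF_b_smul (i j k : ℤ) (φ : F) :
    deltaF i j (b k • φ) = (if k = j then b i • φ else 0) + b k • deltaF i j φ := by
  induction φ using F_induction with
  | h0 => simp
  | hadd x y hx hy =>
    simp only [smul_add, map_add, hx, hy]
    split_ifs
    · abel
    · simp
  | h u m =>
    -- Splitting factors off `[b]_m` until the vacuum lies below `j` makes the explicit derivation
    -- formula applicable.
    obtain ⟨r, hr⟩ : ∃ r : ℕ, m - r < j := ⟨(m - j + 1).toNat, by lia⟩
    rw [← descend_smul_vac m r, smul_smul u]
    generalize u * descend m r = u'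
    rw [smul_smul, deltaF_smul_vac i hr, deltaF_smul_vac i hr, delta_mul, add_smul, smul_smul]
    congr 1
    · rw [b, delta_ι]
      split_ifs with hk
      · rw [hk, elemMat_single_self]; rfl
      · rw [elemMat_single_of_ne i hk, map_zero, zero_mul, zero_smul]
    · rw [smul_smul]

/-- Both sides fix the vacua and obey the same rule under wedging with `b_k`, by
`coeff_sMinus_creation`; again all `n` are treated together. The resulting operator on `B` is the
same in every charge. -/
theorem toV_sigmaMinusF (n : ℕ) (φ : F) : toV (sigmaMinusF n φ) =
    chargeMap 0 (fun _ => (Polynomial.lcoeff B n).toAddMonoidHom.comp sMinus.toAddMonoidHom)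
      (toV φ) := by
  have key : φ ∈ (⨅ n : ℕ, (toV.comp (sigmaMinusF n).toAddMonoidHom).eqLocus
      ((chargeMap 0 fun _ => (Polynomial.lcoeff B n).toAddMonoidHom.comp
        sMinus.toAddMonoidHom).comp toV) : AddSubgroup F) := by
    refine F_mem_of_vac _ 0 (fun m _ => ?_) (fun k φ hφ => ?_) φ
    · rw [AddSubgroup.mem_iInf]
      intro n
      change toV (sigmaMinusF n (vac m)) = chargeMap 0 _ (toV (vac m))
      rw [sigmaMinusF_vac, toV_vac, chargeMap_single, add_zero]
      change _ = Finsupp.single m ((sMinus 1).coeff n)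
      rw [map_one, Polynomial.coeff_one]
      split_ifs
      · rw [toV_vac]
      · simp
    · rw [AddSubgroup.mem_iInf] at hφ ⊢
      intro n
      have hφ' : ∀ n, toV (sigmaMinusF n φ) = chargeMap 0 (fun _ =>
        (Polynomial.lcoeff B n).toAddMonoidHom.comp sMinus.toAddMonoidHom) (toV φ) := hφ
      change toV (sigmaMinusF n (b k • φ)) = chargeMap 0 _ (toV (b k • φ))
      simp only [sigmaMinusF_b_smul, map_sum, toV_b_smul, hφ']
      induction toV φ using Finsupp.induction_linear with
      | zero => simp
      | add x y hx hy => simp only [map_add, Finset.sum_add_distrib, hx, hy]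
      | single m f =>
        simp only [chargeMap_single, raise_single, add_zero]
        refine (map_sum (Finsupp.singleAddHom (m + 1)) _ _).symm.trans ?_
        rw [Finsupp.singleAddHom_apply]
        congr 1
        refine Eq.trans ?_ (coeff_sMinus_creation _ _ _).symm
        refine Finset.sum_congr rfl fun p _ => ?_
        rw [show k - (p.1 : ℤ) - m - 1 = k - m - 1 - p.1 by ring]
        rfl
  exact AddSubgroup.mem_iInf.1 key n

theorem toV_sigmaBarMinusF (n : ℕ) (φ : F) : toV (sigmaBarMinusF n φ) =
    chargeMap 0 (fun _ => (Polynomial.lcoeff B n).toAddMonoidHom.comp sBar.toAddMonoidHom)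
      (toV φ) := by
  have key : φ ∈ (⨅ n : ℕ, (toV.comp (sigmaBarMinusF n).toAddMonoidHom).eqLocus
      ((chargeMap 0 fun _ => (Polynomial.lcoeff B n).toAddMonoidHom.comp
        sBar.toAddMonoidHom).comp toV) : AddSubgroup F) := by
    refine F_mem_of_vac _ 0 (fun m _ => ?_) (fun k φ hφ => ?_) φ
    · rw [AddSubgroup.mem_iInf]
      intro n
      change toV (sigmaBarMinusF n (vac m)) = chargeMap 0 _ (toV (vac m))
      rw [sigmaBarMinusF_vac, toV_vac, chargeMap_single, add_zero]
      change _ = Finsupp.single m ((sBar 1).coeff n)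
      rw [map_one, Polynomial.coeff_one]
      split_ifs
      · rw [toV_vac]
      · simp
    · rw [AddSubgroup.mem_iInf] at hφ ⊢
      intro n
      have hφ' : ∀ n, toV (sigmaBarMinusF n φ) = chargeMap 0 (fun _ =>
        (Polynomial.lcoeff B n).toAddMonoidHom.comp sBar.toAddMonoidHom) (toV φ) := hφ
      change toV (sigmaBarMinusF n (b k • φ)) = chargeMap 0 _ (toV (b k • φ))
      rcases n with _ | n
      · rw [sigmaBarMinusF_zero_b_smul, toV_b_smul, hφ', toV_b_smul]
        induction toV φ using Finsupp.induction_linear with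
        | zero => simp
        | add x y hx hy => simp only [map_add, hx, hy]
        | single m f =>
          simp only [chargeMap_single, raise_single, add_zero]
          exact congrArg _ (coeff_sBar_creation_zero _ _).symm
      · rw [sigmaBarMinusF_succ_b_smul, map_sub, toV_b_smul, toV_b_smul, hφ', hφ', toV_b_smul]
        induction toV φ using Finsupp.induction_linear with
        | zero => simp
        | add x y hx hy => simp only [map_add, ← hx, ← hy]; abel
        | single m f =>
          simp only [chargeMap_single, raise_single, add_zero]
          rw [← Finsupp.single_sub, show k - 1 - m - 1 = k - m - 1 - 1 by ring]
          exact congrArg _ (coeff_sBar_creation _ _ _).symm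
  exact AddSubgroup.mem_iInf.1 key n

/-- The bosonic expression of the elementary matrices as products of a creation and an
annihilation operator. -/
theorem toV_deltaF (i j : ℤ) (φ : F) : toV (deltaF i j φ) =
    chargeMap 0 (fun m => (creation (i - m)).comp (annihilation (m - j))) (toV φ) := by
  refine addHom_ext_F (toV.comp (deltaF i j).toAddMonoidHom) ((chargeMap 0 (fun m =>
    (creation (i - m)).comp (annihilation (m - j)))).comp toV) j (fun m hm => ?_)
    (fun k φ hφ => ?_) φ
  · change toV (deltaF i j (vac m)) = chargeMap 0 _ (toV (vac m))
    rw [deltaF_vac i hm, toV_vac, chargeMap_single, AddMonoidHom.comp_apply, annihilation_one,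
      e_of_neg (by lia), map_zero, map_zero, Finsupp.single_zero]
  · have hφ' : toV (deltaF i j φ) = chargeMap 0 (fun m => (creation (i - m)).comp
      (annihilation (m - j))) (toV φ) := hφ
    change toV (deltaF i j (b k • φ)) = chargeMap 0 _ (toV (b k • φ))
    rw [deltaF_b_smul, map_add, toV_b_smul, toV_b_smul, hφ', apply_ite toV, map_zero, toV_b_smul]
    induction toV φ using Finsupp.induction_linear with
    | zero => simp
    | add x y hx hy =>
      simp only [map_add, ← hx, ← hy]
      split_ifs
      · abel
      · simp
    | single m f =>
      simp only [chargeMap_single, raise_single, add_zero, AddMonoidHom.comp_apply]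
      -- Passing `b_k` through the annihilation operator gives the `δ_{kj} b_i` term and a sign;
      -- passing it through the creation operator gives the second sign.
      have h1 := annihilation_creation (m + 1 - j) (k - m - 1) f
      have h2 := creation_creation (i - m) (k - m) (annihilation (m - j) f)
      rw [show m + 1 - j - 1 = m - j by ring, sub_add_cancel] at h1
      rw [eq_sub_of_add_eq h1, map_sub, ← sub_sub, h2, sub_neg_eq_add, Finsupp.single_add,
        if_congr (show m + 1 - j + (k - m - 1) = 0 ↔ k = j by lia) rfl rfl]
      split_ifs <;> simp

/-! ### Identification of the transported operators on `B`. -/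

theorem sigmaMinusF_bf (m : ℤ) (n : ℕ) (f : B) :
    sigmaMinusF n (bf m f) = bf m ((sMinus f).coeff n) := by
  apply toV_injective
  rw [toV_sigmaMinusF, toV_bf, toV_bf, chargeMap_single, add_zero]
  rfl

theorem sigmaBarMinusF_bf (m : ℤ) (n : ℕ) (f : B) :
    sigmaBarMinusF n (bf m f) = bf m ((sBar f).coeff n) := by
  apply toV_injective
  rw [toV_sigmaBarMinusF, toV_bf, toV_bf, chargeMap_single, add_zero]
  rfl

theorem deltaF_bf (m i j : ℤ) (f : B) :
    deltaF i j (bf m f) = bf m (creation (i - m) (annihilation (m - j) f)) := by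
  apply toV_injective
  rw [toV_deltaF, toV_bf, toV_bf, chargeMap_single, add_zero]
  rfl

theorem sigmaMinusB_spec (f : B) (n : ℕ) :
    bf 0 ((sigmaMinusB f).coeff n) = sigmaMinusF n (bf 0 f) :=
  Classical.epsilon_spec (p := fun P : Polynomial B => ∀ n, bf 0 (P.coeff n) =
    sigmaMinusF n (bf 0 f)) ⟨sMinus f, fun n => (sigmaMinusF_bf 0 n f).symm⟩ n

theorem sigmaBarMinusB_spec (f : B) (n : ℕ) :
    bf 0 ((sigmaBarMinusB f).coeff n) = sigmaBarMinusF n (bf 0 f) :=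
  Classical.epsilon_spec (p := fun P : Polynomial B => ∀ n, bf 0 (P.coeff n) =
    sigmaBarMinusF n (bf 0 f)) ⟨sBar f, fun n => (sigmaBarMinusF_bf 0 n f).symm⟩ n

theorem calB_spec (m i j : ℤ) (f : B) : bf m (calB m i j f) = deltaF i j (bf m f) :=
  Classical.epsilon_spec (p := fun g : B => bf m g = deltaF i j (bf m f))
    ⟨_, (deltaF_bf m i j f).symm⟩

theorem sigmaMinusB_eq (f : B) : sigmaMinusB f = sMinus f :=
  Polynomial.ext fun n => bf_injective 0 (by rw [sigmaMinusB_spec, sigmaMinusF_bf])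

theorem sigmaBarMinusB_eq (f : B) : sigmaBarMinusB f = sBar f :=
  Polynomial.ext fun n => bf_injective 0 (by rw [sigmaBarMinusB_spec, sigmaBarMinusF_bf])

theorem calB_eq (m i j : ℤ) (f : B) :
    calB m i j f = creation (i - m) (annihilation (m - j) f) :=
  bf_injective m (by rw [calB_spec, deltaF_bf])

/-! ### The Jacobi-Trudi formula -/

/-- Row reduction of the larger determinant: subtracting `t` times each row from the next turns the
first column `1, t, t², …` into `1, 0, 0, …` and the other entries below the first row into
`h_{a+1+i} - t h_{a+i}`, the values of `sBar`. -/
theorem sBar_det {r : ℕ} (a : Fin r → ℤ) :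
    sBar (Matrix.det (Matrix.of fun i j : Fin r => h (a j + 1 + i))) =
      Matrix.det (Matrix.of fun i : Fin (r + 1) =>
        (Fin.cons (X ^ (i : ℕ)) fun j => C (h (a j + i)) : Fin (r + 1) → Polynomial B)) := by
  rw [Matrix.det_eq_of_forall_row_eq_smul_add_pred (B := Matrix.of fun i : Fin (r + 1) =>
    (Fin.cases (Fin.cons 1 fun j => C (h (a j))) (fun i => Fin.cons 0 fun j =>
      sBar (h (a j + 1 + i))) i : Fin (r + 1) → Polynomial B)) (fun _ => X)]
  · rw [Matrix.det_succ_column_zero, Fin.sum_univ_succ]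
    simp only [Matrix.of_apply, Fin.cases_zero, Fin.cases_succ, Fin.cons_zero, mul_zero, zero_mul,
      Finset.sum_const_zero, add_zero, Fin.val_zero, pow_zero, mul_one, one_mul]
    rw [RingHom.map_det]
    rfl
  · intro j
    refine Fin.cases ?_ (fun j => ?_) j <;> simp
  · intro i j
    refine Fin.cases ?_ (fun j => ?_) j
    · simp [pow_succ']
    · simp only [Matrix.of_apply, Fin.cases_succ, Fin.cons_succ, sBar_h, Fin.val_succ,
        Fin.val_castSucc]
      rw [show a j + ((i + 1 : ℕ) : ℤ) = a j + 1 + i by push_cast; ring,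
        show a j + 1 + (i : ℤ) - 1 = a j + i by ring, sub_add_cancel]

/-- Expanding `sBar_det` along its first column and applying the `B`-linear `pairing`, which
replaces `t^i` by `h_{n+i}`, gives the expansion of a determinant with a new first column. -/
theorem creation_det {r : ℕ} (n : ℤ) (a : Fin r → ℤ) :
    creation n (Matrix.det (Matrix.of fun i j : Fin r => h (a j + 1 + i))) =
      Matrix.det (Matrix.of fun i j : Fin (r + 1) =>
        h ((Fin.cons n a : Fin (r + 1) → ℤ) j + i)) := by
  rw [creation_apply, sBar_det, Matrix.det_succ_column_zero, Matrix.det_succ_column_zero, map_sum]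
  refine Finset.sum_congr rfl fun i _ => ?_
  have hdet : Matrix.det (Matrix.submatrix (Matrix.of fun i : Fin (r + 1) =>
      (Fin.cons (X ^ (i : ℕ)) fun j => C (h (a j + i)) : Fin (r + 1) → Polynomial B))
        i.succAbove Fin.succ) =
      C (Matrix.det (Matrix.submatrix (Matrix.of fun i j : Fin (r + 1) =>
        h ((Fin.cons n a : Fin (r + 1) → ℤ) j + i)) i.succAbove Fin.succ)) := by
    rw [RingHom.map_det]
    rfl
  rw [hdet, Matrix.of_apply, Matrix.of_apply, Fin.cons_zero, Fin.cons_zero, mul_comm,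
    pairing_C_mul, show ((-1) ^ (i : ℕ) : Polynomial B) = C ((-1) ^ (i : ℕ)) by simp,
    pairing_C_mul, ← mul_one (X ^ (i : ℕ)), pairing_X_pow_mul, pairing_one]
  ring

theorem prod_b_smul_vac (r : ℕ) (m : ℤ) (a : Fin r → ℤ) :
    (List.ofFn fun k => b (a k)).prod • vac (m - r) =
      bf m (Matrix.det (Matrix.of fun i j : Fin r => h (a j - m + i))) := by
  induction r generalizing m with
  | zero => simp [bf_one]
  | succ r ih =>
    have h1 := ih (m - 1) fun k => a k.succ
    rw [List.ofFn_succ, List.prod_cons, ← smul_smul,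
      show m - ((r + 1 : ℕ) : ℤ) = m - 1 - r by push_cast; ring, h1, b_smul_bf, sub_add_cancel]
    congr 1
    have h2 := creation_det (a 0 - (m - 1) - 1) fun k : Fin r => a k.succ - m
    refine Eq.trans ?_ (h2.trans ?_)
    · refine congrArg (fun A => creation _ (Matrix.det A)) (Matrix.ext fun i j => ?_)
      simp only [Matrix.of_apply]
      congr 1; ring
    · refine congrArg Matrix.det (Matrix.ext fun i j => ?_)
      refine Fin.cases ?_ (fun j => ?_) j
      · simp only [Matrix.of_apply, Fin.cons_zero]
        congr 1; ring
      · simp only [Matrix.of_apply, Fin.cons_succ]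

theorem bf_schurDet (m : ℤ) (lam : YoungDiagram) (r : ℕ) :
    bf m (schurDet lam r) = bLam m lam r := by
  rw [bLam, prod_b_smul_vac r m fun k : Fin r => m - (k : ℤ) + (lam.rowLen k : ℤ)]
  refine congrArg (fun A => bf m (Matrix.det A)) (Matrix.ext fun i j => ?_)
  simp only [Matrix.of_apply]
  congr 1; ring

/-! ### The image of `B` is the Fock space of charge `m` -/

theorem prod_map_b_perm {l l' : List ℤ} (hl : l.Perm l') :
    (l.map b).prod = (l'.map b).prod ∨ (l.map b).prod = -(l'.map b).prod := by
  induction hl with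
  | nil => exact Or.inl rfl
  | cons x _ ih =>
    rcases ih with ih | ih
    · left; simp [ih]
    · right; simp [ih]
  | swap x y l =>
    right
    rw [List.map_cons, List.map_cons, List.map_cons, List.map_cons, List.prod_cons, List.prod_cons,
      List.prod_cons, List.prod_cons, ← mul_assoc, ← mul_assoc, b_mul_b_swap, neg_mul]
  | trans _ _ ih1 ih2 =>
    rcases ih1 with ih1 | ih1 <;> rcases ih2 with ih2 | ih2 <;> rw [ih1, ih2] <;> simp

theorem prod_map_b_of_not_nodup {l : List ℤ} (hl : ¬l.Nodup) : (l.map b).prod = 0 := by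
  rw [List.nodup_iff_sublist] at hl
  push Not at hl
  obtain ⟨a, ha⟩ := hl
  obtain ⟨l', hl'⟩ := ha.exists_perm_append
  have h0 : (([a, a] ++ l').map b).prod = 0 := by
    simp only [List.cons_append, List.nil_append, List.map_cons, List.prod_cons]
    rw [← mul_assoc, b_mul_self, zero_mul]
  rcases prod_map_b_perm hl' with h1 | h1
  · rw [h1, h0]
  · rw [h1, h0, neg_zero]

theorem bLam_mem_Fock (m : ℤ) (lam : YoungDiagram) (r : ℕ) (hr : lam.colLen 0 ≤ r) :
    bLam m lam r ∈ Fock m := Submodule.subset_span ⟨lam, r, hr, rfl⟩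

/-- A strictly decreasing list of indices above `m - r` gives a basis vector. -/
theorem prod_map_b_smul_vac_mem_of_sorted (m : ℤ) (l : List ℤ) (hl : l.Pairwise (· > ·))
    (hm : ∀ k ∈ l, m - l.length < k) : (l.map b).prod • vac (m - l.length) ∈ Fock m := by
  -- The entries drop by at least one per place, so counting back from the last entry, which exceeds
  -- `m - r`, gives `l[i] ≥ m - i`. The excesses `l[i] - (m - i)` are the parts of the partition.
  have hstep : ∀ (d i : ℕ) (hi : i + d < l.length), l[i + d] + d ≤ l[i] := by
    intro d
    induction d with
    | zero => intro i hi; simp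
    | succ d ih =>
      intro i hi
      have h1 := ih i (by lia)
      have h2 : l[i + d] > l[i + (d + 1)] :=
        List.pairwise_iff_getElem.1 hl (i + d) (i + (d + 1)) (by lia) hi (by lia)
      push_cast
      lia
  have hge : ∀ (i : ℕ) (hi : i < l.length), m - i ≤ l[i] := by
    intro i hi
    have h1 := hstep (l.length - 1 - i) i (by lia)
    have h2 := hm _ (List.getElem_mem (show i + (l.length - 1 - i) < l.length by lia))
    lia
  set w : List ℕ := List.ofFn fun k : Fin l.length => (l[k] - (m - (k : ℤ))).toNat with hw
  have hws : w.SortedGE := by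
    refine List.Pairwise.sortedGE ?_
    rw [hw, List.pairwise_ofFn]
    intro i j hij
    have h1 := hstep (j - i) i (by lia)
    have h2 := hge i i.2
    simp only [show (i : ℕ) + (j - i) = j by lia] at h1
    simp only [Fin.getElem_fin]
    lia
  have hrow : ∀ k : Fin l.length,
      ((YoungDiagram.ofRowLens w hws).rowLen k : ℤ) = l[k] - (m - (k : ℤ)) := by
    intro k
    have hk : (k : ℕ) < w.length := by rw [hw, List.length_ofFn]; exact k.2
    have h1 := YoungDiagram.rowLen_ofRowLens (hw := hws) ⟨k, hk⟩
    rw [h1]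
    simp only [hw, Fin.getElem_fin, List.getElem_ofFn]
    have := hge k k.2
    lia
  have hcol : (YoungDiagram.ofRowLens w hws).colLen 0 ≤ l.length := by
    by_contra hlt
    rw [not_le, ← YoungDiagram.mem_iff_lt_colLen, YoungDiagram.mem_ofRowLens] at hlt
    obtain ⟨h1, -⟩ := hlt
    rw [hw, List.length_ofFn] at h1
    exact lt_irrefl _ h1
  have := bLam_mem_Fock m _ _ hcol
  rw [bLam] at this
  convert this using 3
  refine List.ext_getElem (by simp) fun i h1 h2 => ?_
  rw [List.getElem_map, List.getElem_ofFn]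
  have := hrow ⟨i, by simpa using h1⟩
  simp only [Fin.getElem_fin] at this ⊢
  rw [this]
  congr 1; ring

/-- A repeated index gives zero. Otherwise sorting changes only the sign, and an index at most `m -
r` can be moved next to the vacuum, which it kills; what remains comes from a partition. -/
theorem prod_map_b_smul_vac_mem (m : ℤ) (l : List ℤ) :
    (l.map b).prod • vac (m - l.length) ∈ Fock m := by
  by_cases hd : l.Nodup
  · have hp := List.perm_insertionSort (· ≥ ·) l
    set l' := l.insertionSort (· ≥ ·) with hl'
    have hlen : l'.length = l.length := hp.length_eq
    have hs : l'.Pairwise (· > ·) := by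
      have h1 : l'.Pairwise (· ≥ ·) := List.pairwise_insertionSort (· ≥ ·) l
      have h2 : l'.Pairwise (· ≠ ·) := hp.nodup_iff.2 hd
      exact (h1.and h2).imp fun h => lt_of_le_of_ne h.1 h.2.symm
    have hmem : (l'.map b).prod • vac (m - l'.length) ∈ Fock m := by
      by_cases hm : ∀ k ∈ l', m - l'.length < k
      · exact prod_map_b_smul_vac_mem_of_sorted m l' hs hm
      · push Not at hm
        obtain ⟨k, hk, hkm⟩ := hm
        have hp' : l'.Perm (l'.erase k ++ [k]) :=
          (List.perm_cons_erase hk).trans (List.perm_append_singleton _ _).symm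
        have h0 : ((l'.erase k ++ [k]).map b).prod • vac (m - l'.length) = 0 := by
          rw [List.map_append, List.prod_append, ← smul_smul, List.map_singleton,
            List.prod_singleton, b_smul_vac_of_le hkm, smul_zero]
        rcases prod_map_b_perm hp' with h1 | h1
        · rw [h1, h0]; exact (Fock m).zero_mem
        · rw [h1, neg_smul, h0, neg_zero]; exact (Fock m).zero_mem
    rw [hlen] at hmem
    rcases prod_map_b_perm hp with h1 | h1
    · rwa [h1] at hmem
    · rw [h1, neg_smul] at hmem
      simpa using (Fock m).neg_mem hmem
  · rw [prod_map_b_of_not_nodup hd, zero_smul]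
    exact (Fock m).zero_mem

theorem b_smul_prod_map_b_mem {m k : ℤ} {φ : F} (hφ : φ ∈ Submodule.span ℤ
    (Set.range fun l : List ℤ => (l.map b).prod • vac (m - l.length))) :
    b k • φ ∈ Submodule.span ℤ
      (Set.range fun l : List ℤ => (l.map b).prod • vac (m + 1 - l.length)) := by
  induction hφ using Submodule.span_induction with
  | mem x hx =>
    obtain ⟨l, rfl⟩ := hx
    refine Submodule.subset_span ⟨k :: l, ?_⟩
    simp only [List.map_cons, List.prod_cons, List.length_cons, smul_smul]
    congr 2; push_cast; ring
  | zero => rw [smul_zero]; exact Submodule.zero_mem _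
  | add x y _ _ hx hy => rw [smul_add]; exact Submodule.add_mem _ hx hy
  | smul c x _ hx => rw [smul_comm]; exact Submodule.smul_mem _ c hx

theorem sigmaPlusF_prod_map_b_mem (l : List ℤ) (n : ℕ) (m : ℤ) :
    sigmaPlusF n ((l.map b).prod • vac (m - l.length)) ∈ Submodule.span ℤ
      (Set.range fun l : List ℤ => (l.map b).prod • vac (m - l.length)) := by
  induction l generalizing n m with
  | nil =>
    refine Submodule.subset_span ⟨[m + n], ?_⟩
    simp [sigmaPlusF_vac]
  | cons k l ih =>
    rw [List.map_cons, List.prod_cons, ← smul_smul, sigmaPlusF_b_smul]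
    refine Submodule.sum_mem _ fun p _ => ?_
    have h1 := b_smul_prod_map_b_mem (k := k + p.1) (ih p.2 (m - 1))
    rw [sub_add_cancel] at h1
    rwa [List.length_cons, show m - ((l.length + 1 : ℕ) : ℤ) = m - 1 - l.length by push_cast; ring]

/-- Products over arbitrary lists are the spanning set on which stability under `σ_n` is visible,
since `σ_n` does not preserve the shape of a partition vector. -/
theorem Fock_eq_span (m : ℤ) : Fock m = Submodule.span ℤ
    (Set.range fun l : List ℤ => (l.map b).prod • vac (m - l.length)) := by
  refine le_antisymm (Submodule.span_le.2 ?_) (Submodule.span_le.2 ?_)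
  · rintro _ ⟨lam, r, -, rfl⟩
    refine Submodule.subset_span ⟨List.ofFn fun k : Fin r => m - (k : ℤ) + (lam.rowLen k : ℤ), ?_⟩
    simp only [List.map_ofFn, List.length_ofFn]
    rfl
  · rintro _ ⟨l, rfl⟩
    exact prod_map_b_smul_vac_mem m l

theorem sigmaPlusF_mem_Fock (n : ℕ) (m : ℤ) {φ : F} (hφ : φ ∈ Fock m) :
    sigmaPlusF n φ ∈ Fock m := by
  rw [Fock_eq_span] at hφ ⊢
  induction hφ using Submodule.span_induction with
  | mem x hx =>
    obtain ⟨l, rfl⟩ := hx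
    exact sigmaPlusF_prod_map_b_mem l n m
  | zero => rw [map_zero]; exact Submodule.zero_mem _
  | add x y _ _ hx hy => rw [map_add]; exact Submodule.add_mem _ hx hy
  | smul c x _ hx => rw [map_smul]; exact Submodule.smul_mem _ c hx

/-- One inclusion holds because `F_m` contains `[b]_m` and is stable under the `σ_n`; the other is
the determinant formula on the spanning vectors. -/
theorem range_bf (m : ℤ) : Set.range (bf m) = (Fock m : Set F) := by
  apply Set.Subset.antisymm
  · rintro _ ⟨f, rfl⟩
    rw [SetLike.mem_coe]
    induction f using B_induction with
    | h1 => rw [bf_one]; simpa using prod_map_b_smul_vac_mem m []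
    | hadd f g hf hg => rw [bf_add]; exact (Fock m).add_mem hf hg
    | hneg f hf => rw [bf_neg]; exact (Fock m).neg_mem hf
    | hmul n f hf => rw [bf_h_mul]; exact sigmaPlusF_mem_Fock n m hf
  · intro φ hφ
    induction hφ using Submodule.span_induction with
    | mem x hx =>
      obtain ⟨lam, r, -, rfl⟩ := hx
      exact ⟨_, bf_schurDet m lam r⟩
    | zero => exact ⟨0, bf_zero m⟩
    | add x y _ _ hx hy =>
      obtain ⟨f, rfl⟩ := hx
      obtain ⟨g, rfl⟩ := hy
      exact ⟨f + g, bf_add m f g⟩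
    | smul c x _ hx =>
      obtain ⟨f, rfl⟩ := hx
      exact ⟨c • f, by simp [bf, act]⟩

/-! ### Coefficients of the vertex operator -/

theorem coeff_ofPowerSeries {R : Type} [CommRing R] (A : PowerSeries R) (n : ℤ) :
    (HahnSeries.ofPowerSeries ℤ R A).coeff n = zcoeff A n := by
  rw [PowerSeries.coeff_coe, zcoeff]
  split_ifs with h1 h2 h2
  · lia
  · rfl
  · rw [show n.natAbs = n.toNat by lia]
  · lia

theorem zcoeff_mul {R : Type} [CommRing R] (A A' : PowerSeries R) (n : ℤ) (K : ℕ) (hK : n < K) :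
    zcoeff (A * A') n = ∑ k ∈ Finset.range K, PowerSeries.coeff k A * zcoeff A' (n - k) := by
  rcases lt_or_ge n 0 with hn | hn
  · rw [zcoeff_of_neg _ hn]
    exact (Finset.sum_eq_zero fun k _ => by rw [zcoeff_of_neg _ (by lia), mul_zero]).symm
  · lift n to ℕ using hn
    rw [zcoeff_natCast, PowerSeries.coeff_mul, Finset.Nat.sum_antidiagonal_eq_sum_range_succ_mk]
    refine Finset.sum_subset_zero_on_sdiff ?_ ?_ ?_
    · intro k hk
      rw [Finset.mem_range] at hk ⊢
      lia
    · intro k hk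
      rw [Finset.mem_sdiff, Finset.mem_range, Finset.mem_range] at hk
      rw [zcoeff_of_neg _ (by lia), mul_zero]
    · intro k hk
      rw [Finset.mem_range] at hk
      rw [← zcoeff_natCast A', Nat.cast_sub (by lia)]

/-- The outer coefficient is that of `w`, the inner that of `z`. The term `(w/z)^k` shifts them to
`n - k` and `r + k`, and the sum is finite since `e` vanishes in negative degrees. -/
theorem coeff_iExp_mul (n r : ℤ) (K : ℕ) (hK : n < K) :
    ((iExp * (inW E * inZ H)).coeff n).coeff r =
      ∑ k ∈ Finset.range K, e (n - k) * h (r + k) := by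
  rw [iExp, inW, inZ, ← HahnSeries.ofPowerSeries_C, ← map_mul, ← map_mul, coeff_ofPowerSeries,
    zcoeff_mul _ _ n K hK, HahnSeries.coeff_sum]
  refine Finset.sum_congr rfl fun k _ => ?_
  rw [PowerSeries.coeff_mk, HahnSeries.coeff_single_mul, one_mul]
  have h1 : zcoeff (PowerSeries.map HahnSeries.C E *
      PowerSeries.C (HahnSeries.ofPowerSeries ℤ B H)) (n - k) =
      HahnSeries.C (e (n - k)) * HahnSeries.ofPowerSeries ℤ B H := by
    rw [e, ← zcoeff_map]
    unfold zcoeff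
    split_ifs
    · rw [PowerSeries.coeff_mul_C]
    · rw [zero_mul]
  rw [h1, HahnSeries.C_apply, HahnSeries.coeff_single_mul, coeff_ofPowerSeries, h_eq_zcoeff]
  congr 2; ring

theorem coeff_monom_mul (p q i j : ℤ) (c : B) (G : L) :
    ((monom p q c * G).coeff j).coeff i = c * (G.coeff (j - q)).coeff (i - p) := by
  rw [monom, HahnSeries.coeff_single_mul, HahnSeries.coeff_single_mul]

theorem monom_mul_monom (p q p' q' : ℤ) (c c' : B) :
    monom p q c * monom p' q' c' = monom (p + p') (q + q') (c * c') := by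
  rw [monom, monom, HahnSeries.single_mul_single, HahnSeries.single_mul_single]; rfl

/-- Both sides expand into the same triple sum: over the powers of `w⁻¹` from `σ₋(w)`, those of
`z⁻¹` from `σ̄₋(z)`, and the powers of `w/z`, which on the right come from `creation_e_mul`. -/
theorem coeff_vertex (m i j : ℤ) (f : B) :
    ((monom m (-m) 1 * iExp * Gam f).coeff (-j)).coeff i =
      creation (i - m) (annihilation (m - j) f) := by
  have hterm : ∀ (p q : ℕ) (c : B) (K : ℕ), m - j + q < K →
      ((monom m (-m) 1 * iExp * (inW E * inZ H * monom (-(p : ℤ)) (-(q : ℤ)) c)).coeff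
        (-j)).coeff i = ∑ k ∈ Finset.range K, e (m - j + q - k) * (h (i - m + k + p) * c) := by
    intro p q c K hK
    rw [show monom m (-m) 1 * iExp * (inW E * inZ H * monom (-(p : ℤ)) (-(q : ℤ)) c) =
      (monom m (-m) 1 * monom (-(p : ℤ)) (-(q : ℤ)) c) * (iExp * (inW E * inZ H)) by ring,
      monom_mul_monom, coeff_monom_mul, one_mul, coeff_iExp_mul _ _ K (by lia), Finset.mul_sum]
    refine Finset.sum_congr rfl fun k _ => ?_
    rw [show -j - (-m + -(q : ℤ)) - k = m - j + q - k by ring,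
      show i - (m + -(p : ℤ)) + k = i - m + k + p by ring]
    ring
  rw [annihilation_apply, pairing, Polynomial.lsum_apply, Gam, sigmaSigma, sigmaMinusB_eq,
    Polynomial.sum_def, Polynomial.sum_def, map_sum, Finset.mul_sum, Finset.mul_sum,
    HahnSeries.coeff_sum, HahnSeries.coeff_sum]
  refine Finset.sum_congr rfl fun q _ => ?_
  have hK : m - j + q < ((m - j + q).toNat + 1 : ℕ) := by lia
  rw [LinearMap.smul_apply, LinearMap.id_apply, smul_eq_mul, creation_e_mul _ _ _ _ hK,
    sigmaBarMinusB_eq, Polynomial.sum_def, Finset.mul_sum, Finset.mul_sum,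
    HahnSeries.coeff_sum, HahnSeries.coeff_sum]
  simp only [hterm _ _ _ _ hK]
  rw [Finset.sum_comm]
  refine Finset.sum_congr rfl fun k _ => ?_
  rw [← Finset.mul_sum, creation_apply, pairing, Polynomial.lsum_apply, Polynomial.sum_def]
  rfl

end DJKM

theorem mainTheorem2 (m : ℤ) :
    Function.Injective (DJKM.bf m) ∧
    Set.range (DJKM.bf m) = (DJKM.Fock m : Set DJKM.F) ∧
    (∀ (lam : YoungDiagram) (r : ℕ), lam.colLen 0 ≤ r →
      DJKM.bf m (DJKM.schurDet lam r) = DJKM.bLam m lam r) ∧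
    (∀ (f : DJKM.B) (n : ℕ),
      DJKM.bf 0 ((DJKM.sigmaMinusB f).coeff n) = DJKM.sigmaMinusF n (DJKM.bf 0 f)) ∧
    (∀ (f : DJKM.B) (n : ℕ),
      DJKM.bf 0 ((DJKM.sigmaBarMinusB f).coeff n) = DJKM.sigmaBarMinusF n (DJKM.bf 0 f)) ∧
    (∀ (f : DJKM.B) (i j : ℤ),
      DJKM.bf m (DJKM.calB m i j f) = DJKM.deltaF i j (DJKM.bf m f)) ∧
    (∀ (f : DJKM.B) (i j : ℤ),
      DJKM.calB m i j f =
        ((DJKM.monom m (-m) 1 * DJKM.iExp * DJKM.Gam f).coeff (-j)).coeff i) :=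
  ⟨DJKM.bf_injective m, DJKM.range_bf m, fun lam r _ => DJKM.bf_schurDet m lam r,
    DJKM.sigmaMinusB_spec, DJKM.sigmaBarMinusB_spec, fun f i j => DJKM.calB_spec m i j f,
    fun f i j => (DJKM.calB_eq m i j f).trans (DJKM.coeff_vertex m i j f).symm⟩
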